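/- Let $\Omega_X,\Omega_Y\subset\mathbb R^d$ be bounded Lipschitz domains, and let $A:\Omega_X\to\Omega_Y$ be a $C^1$-diffeomorphism with $\inf_{x\in\Omega_X}|\det DA(x)|>0$. For $\sigma\in\mathbb N_0$, let $H^\sigma(\Omega)$ be the real $L^2$-Sobolev space with norm $\|f\|_{H^\sigma(\Omega)}^2=\sum_{|\alpha|\le\sigma}\|D^\alpha f\|_{L^2(\Omega)}^2$ (weak derivatives), let $C_b^\sigma(\Omega_X,\mathbb R^d)$ be the space of $C^\sigma$-vector fields on $\Omega_X$ with bounded derivatives up to order $\sigma$, and let $\mathcal K_Af:=f\circ A$ be the Koopman operator. Put $c_0:=\sup_{x\in\Omega_X}|\det DA(x)|^{-1}$. For $\alpha\in\mathbb N_0^d$ let $\mathcal P(\alpha)$ be the set of all vectors $\beta\in\{1,\dots,d\}^{|\alpha|}$ in which each index $i$ appears exactly $\alpha_i$ times, and let $\Pi_m$ be the set of all partitions $\pi=\{B_1,\dots,B_{|\pi|}\}$ of $\{1,\dots,m\}$ into non-empty blocks. For $|\alpha|=m$ and any $\beta\in\mathcal P(\alpha)$ define $$S_\alpha(A):=\sup_{x\in\Omega_X}\Bigg(|\det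 DA(x)|^{-1}\sum_{k=1}^{m}\ \sum_{|\alpha'|=k}\Bigg|\sum_{\pi\in\Pi_m,\ |\pi|=k}\ \sum_{\beta'\in\mathcal P(\alpha')}\partial_{\beta,B_1}A_{\beta'_1}(x)\cdots\partial_{\beta,B_k}A_{\beta'_k}(x)\Bigg|^2\Bigg),$$ where $\partial_{\beta,B}:=\partial_{\beta_{j_1}}\cdots\partial_{\beta_{j_\ell}}$ for a block $B=\{j_1,\dots,j_\ell\}$. (i) Let $\sigma\in\mathbb N$, $\sigma\ge1$, and $A\in C_b^\sigma(\Omega_X,\mathbb R^d)$. Then, for $|\alpha|\le\sigma$, $S_\alpha(A)$ does not depend on the choice of $\beta\in\mathcal P(\alpha)$, and $\mathcal K_A$ is a well-defined bounded linear operator from $H^\sigma(\Omega_Y)$ to $H^\sigma(\Omega_X)$ with $$\|\mathcal K_A\|_{H^\sigma(\Omega_Y)\to H^\sigma(\Omega_X)}\le\Bigg(\max\Bigg\{c_0,\ \sum_{1\le|\alpha|\le\sigma}S_\alpha(A)\Bigg\}\Bigg)^{1/2}.$$ (ii) If $A\in C_b^1(\Omega_X,\mathbb R^d)$, then $$\|\mathcal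 K_A\|_{H^1(\Omega_Y)\to H^1(\Omega_X)}\le\Bigg(\max\Bigg\{c_0,\ \sup_{x\in\Omega_X}\frac{\|DA(x)\|_F^2}{|\det DA(x)|}\Bigg\}\Bigg)^{1/2},$$ where $\|\cdot\|_F$ is the Frobenius norm. -/

import Mathlib

open MeasureTheory Set Topology
open scoped ENNReal NNReal ContDiff

noncomputable section

namespace KoopmanSobolev

/-- Euclidean space `ℝ^d`. -/
abbrev Euc (d : ℕ) : Type := EuclideanSpace ℝ (Fin d)

/-- The `i`-th standard basis vector of `ℝ^d`. -/
abbrev stdVec {d : ℕ} (i : Fin d) : Euc d := EuclideanSpace.single i (1 : ℝ)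

/-! ### Domains and maps -/

/-- A bounded domain (non-empty connected open set) with Lipschitz boundary: near every boundary
point, up to a rigid motion `T`, the domain is the set of points lying below the graph of a
Lipschitz function `φ` of the other `d - 1` coordinates. -/
structure IsBoundedLipschitzDomain {d : ℕ} (Ω : Set (Euc d)) : Prop where
  isOpen : IsOpen Ω
  isConnected : IsConnected Ω
  isBounded : Bornology.IsBounded Ω
  lipschitzBoundary : ∀ x ∈ frontier Ω, ∃ U ∈ 𝓝 x, ∃ (i : Fin d)
    (φ : EuclideanSpace ℝ {j : Fin d // j ≠ i} → ℝ) (L : ℝ≥0) (T : Euc d ≃ᵃⁱ[ℝ] Euc d),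
      LipschitzWith L φ ∧
      U ∩ Ω = U ∩ T '' {y : Euc d | y i < φ (WithLp.toLp 2 fun j => y j)}

/-- `A` restricts to a `C¹`-diffeomorphism from the open set `X` onto the open set `Y`
(the values of `A` outside `X` are irrelevant). -/
structure IsC1Diffeo {d : ℕ} (A : Euc d → Euc d) (X Y : Set (Euc d)) : Prop where
  mapsTo : MapsTo A X Y
  contDiffOn : ContDiffOn ℝ 1 A X
  exists_inverse : ∃ B : Euc d → Euc d, MapsTo B Y X ∧ ContDiffOn ℝ 1 B Y ∧
    LeftInvOn B A X ∧ RightInvOn B A Y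

/-- `A ∈ C_b^k(Ω, ℝ^d)` for an open set `Ω`: `A` is `C^k` on `Ω` with bounded derivatives up to
order `k`. -/
def IsCb {d : ℕ} (k : ℕ) (A : Euc d → Euc d) (Ω : Set (Euc d)) : Prop :=
  ContDiffOn ℝ k A Ω ∧ ∀ j ≤ k, ∃ M : ℝ, ∀ x ∈ Ω, ‖iteratedFDeriv ℝ j A x‖ ≤ M

/-- The absolute value `|det DA(x)|` of the Jacobian determinant. -/
def absDet {d : ℕ} (A : Euc d → Euc d) (x : Euc d) : ℝ := |(fderiv ℝ A x).det|

/-- The squared Frobenius norm `‖DA(x)‖_F²` of the Jacobian matrix `(∂_j A_i(x))_{i,j}`. -/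
def frobSq {d : ℕ} (A : Euc d → Euc d) (x : Euc d) : ℝ :=
  ∑ i : Fin d, ∑ j : Fin d, (fderiv ℝ A x (stdVec j) i) ^ 2

/-! ### Multi-indices and partial derivatives -/

/-- `β ∈ P(α)`: every index `k` appears exactly `α k` times in the vector `β`.
This forces `n = |α|`. -/
def IsArrangement {d n : ℕ} (α : Fin d → ℕ) (β : Fin n → Fin d) : Prop :=
  ∀ k : Fin d, (Finset.univ.filter fun j => β j = k).card = α k

/-- The arrangement `(1, …, 1, 2, …, 2, …, d, …, d)` of the multi-index `α`. -/
def stdArr {d : ℕ} (α : Fin d → ℕ) : Fin (∑ i, α i) → Fin d :=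
  fun j => (finSigmaFinEquiv.symm j).1

theorem isArrangement_stdArr {d : ℕ} (α : Fin d → ℕ) : IsArrangement α (stdArr α) := by
  intro k
  rw [← Fintype.card_fin (α k), ← Finset.card_univ]
  symm
  refine Finset.card_bij (fun r _ => finSigmaFinEquiv ⟨k, r⟩) ?_ ?_ ?_
  · intro r _
    refine Finset.mem_filter.2 ⟨Finset.mem_univ _, ?_⟩
    simp [stdArr]
  · intro r _ s _ h
    simpa using h
  · intro j hj
    obtain ⟨⟨i, r⟩, rfl⟩ := finSigmaFinEquiv.surjective j
    have h : i = k := by simpa [stdArr] using (Finset.mem_filter.1 hj).2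
    subst h
    exact ⟨r, Finset.mem_univ _, rfl⟩

/-- The iterated partial derivative `∂_{β_1} ⋯ ∂_{β_n} g (x)`. -/
def partialDeriv {d n : ℕ} (β : Fin n → Fin d) (g : Euc d → ℝ) (x : Euc d) : ℝ :=
  iteratedFDeriv ℝ n g x fun r => stdVec (β r)

/-- `D^α g (x)`; for smooth `g` the order of the differentiations does not matter. -/
def multiDeriv {d : ℕ} (α : Fin d → ℕ) (g : Euc d → ℝ) (x : Euc d) : ℝ :=
  partialDeriv (stdArr α) g x

/-- The finite set of multi-indices `α ∈ ℕ₀^d` with `|α| ≤ σ`. -/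
def multiIdx (d σ : ℕ) : Finset (Fin d → ℕ) :=
  (Finset.range (σ + 1)).biUnion fun m => Finset.piAntidiag Finset.univ m

theorem mem_multiIdx {d σ : ℕ} {α : Fin d → ℕ} : α ∈ multiIdx d σ ↔ ∑ i, α i ≤ σ := by
  simp [multiIdx]

/-! ### Sobolev spaces -/

/-- The real Lebesgue space `L²(Ω)`. -/
abbrev L2 {d : ℕ} (Ω : Set (Euc d)) : Type := Lp ℝ 2 (volume.restrict Ω)

/-- `φ` is a test function on `Ω`, that is, `φ ∈ C_c^∞(Ω)`. -/
structure IsTestFun {d : ℕ} (Ω : Set (Euc d)) (φ : Euc d → ℝ) : Prop where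
  contDiff : ContDiff ℝ ∞ φ
  hasCompactSupport : HasCompactSupport φ
  tsupport_subset : tsupport φ ⊆ Ω

/-- `g` is the weak derivative `D^α f` in `Ω`. -/
def IsWeakDeriv {d : ℕ} (Ω : Set (Euc d)) (α : Fin d → ℕ) (f g : L2 Ω) : Prop :=
  ∀ φ : Euc d → ℝ, IsTestFun Ω φ →
    ∫ x in Ω, f x * multiDeriv α φ x = (-1) ^ (∑ i, α i) * ∫ x in Ω, g x * φ x

theorem IsTestFun.memLp {d : ℕ} {Ω : Set (Euc d)} {φ : Euc d → ℝ} (h : IsTestFun Ω φ) :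
    MemLp φ 2 (volume.restrict Ω) :=
  (h.contDiff.continuous.memLp_of_hasCompactSupport h.hasCompactSupport).restrict Ω

theorem IsTestFun.memLp_multiDeriv {d : ℕ} {Ω : Set (Euc d)} {φ : Euc d → ℝ}
    (h : IsTestFun Ω φ) (α : Fin d → ℕ) : MemLp (multiDeriv α φ) 2 (volume.restrict Ω) := by
  have hc : Continuous (multiDeriv α φ) := by
    have h1 : Continuous (iteratedFDeriv ℝ (∑ i, α i) φ) :=
      h.contDiff.continuous_iteratedFDeriv (by exact_mod_cast le_top)
    exact (ContinuousMultilinearMap.apply ℝ _ ℝ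
      (fun r => stdVec (stdArr α r))).continuous.comp h1
  have hs : HasCompactSupport (multiDeriv α φ) :=
    (h.hasCompactSupport.iteratedFDeriv (𝕜 := ℝ) (∑ i, α i)).comp_left
      (g := fun M : Euc d [×(∑ i, α i)]→L[ℝ] ℝ => M fun r => stdVec (stdArr α r)) rfl
  exact (hc.memLp_of_hasCompactSupport hs).restrict Ω

theorem integral_add_mul {d : ℕ} {Ω : Set (Euc d)} (f g : L2 Ω) {ψ : Euc d → ℝ}
    (hψ : MemLp ψ 2 (volume.restrict Ω)) :
    ∫ x in Ω, (f + g : L2 Ω) x * ψ x = (∫ x in Ω, f x * ψ x) + ∫ x in Ω, g x * ψ x := by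
  have hf : Integrable (fun x => f x * ψ x) (volume.restrict Ω) :=
    (Lp.memLp f).integrable_mul hψ
  have hg : Integrable (fun x => g x * ψ x) (volume.restrict Ω) :=
    (Lp.memLp g).integrable_mul hψ
  rw [← integral_add hf hg]
  refine integral_congr_ae ?_
  filter_upwards [Lp.coeFn_add f g] with x hx
  rw [hx, Pi.add_apply, add_mul]

theorem integral_smul_mul {d : ℕ} {Ω : Set (Euc d)} (c : ℝ) (f : L2 Ω) (ψ : Euc d → ℝ) :
    ∫ x in Ω, (c • f : L2 Ω) x * ψ x = c * ∫ x in Ω, f x * ψ x := by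
  rw [← integral_const_mul]
  refine integral_congr_ae ?_
  filter_upwards [Lp.coeFn_smul c f] with x hx
  rw [hx, Pi.smul_apply, smul_eq_mul, mul_assoc]

theorem integral_zero_mul {d : ℕ} {Ω : Set (Euc d)} (ψ : Euc d → ℝ) :
    ∫ x in Ω, (0 : L2 Ω) x * ψ x = 0 := by
  simpa using integral_smul_mul (Ω := Ω) 0 0 ψ

/-- The index `0` in the set of multi-indices of order at most `σ`. -/
def zeroIdx (d σ : ℕ) : multiIdx d σ := ⟨0, mem_multiIdx.2 (by simp)⟩

/-- The Sobolev space `H^σ(Ω)`, `σ ∈ ℕ₀`. A function `f ∈ L²(Ω)` with weak derivatives in `L²(Ω)`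
up to order `σ` is recorded together with the family `(D^α f)_{|α| ≤ σ}` of these derivatives
(which `f` determines). The norm is the one of the `ℓ²`-product of copies of `L²(Ω)`, so that
`‖f‖² = ∑_{|α| ≤ σ} ‖D^α f‖²_{L²(Ω)}`. -/
def SobolevH {d : ℕ} (σ : ℕ) (Ω : Set (Euc d)) :
    Submodule ℝ (PiLp 2 fun _ : multiIdx d σ => L2 Ω) where
  carrier := {u | ∀ α : multiIdx d σ, IsWeakDeriv Ω α (u (zeroIdx d σ)) (u α)}
  zero_mem' := by
    intro α φ _
    simp only [PiLp.zero_apply, integral_zero_mul, mul_zero]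
  add_mem' := by
    intro u v hu hv α φ hφ
    simp only [PiLp.add_apply]
    rw [integral_add_mul _ _ (hφ.memLp_multiDeriv _), integral_add_mul _ _ hφ.memLp,
      hu α φ hφ, hv α φ hφ, mul_add]
  smul_mem' := by
    intro c u hu α φ hφ
    simp only [PiLp.smul_apply]
    rw [integral_smul_mul, integral_smul_mul, hu α φ hφ]
    ring

/-- The `L²`-function underlying an element of `H^σ(Ω)`. -/
def sobFn {d σ : ℕ} {Ω : Set (Euc d)} (u : SobolevH σ Ω) : L2 Ω :=
  (u : PiLp 2 fun _ : multiIdx d σ => L2 Ω) (zeroIdx d σ)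

/-- An element of `H^σ(Ω)` is determined by its underlying function. -/
theorem sobFn_injective {d σ : ℕ} {Ω : Set (Euc d)} (hΩ : IsOpen Ω) :
    Function.Injective (sobFn : SobolevH σ Ω → L2 Ω) := by
  suffices h : ∀ u : SobolevH σ Ω, sobFn u = 0 → u = 0 by
    intro u v huv
    refine sub_eq_zero.1 (h _ ?_)
    have : sobFn (u - v) = sobFn u - sobFn v := rfl
    rw [this, huv, sub_self]
  intro u hu
  refine Subtype.ext (PiLp.ext fun α => ?_)
  refine (Lp.eq_zero_iff_ae_eq_zero).2 ?_
  rw [Filter.EventuallyEq, ae_restrict_iff' hΩ.measurableSet]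
  refine hΩ.ae_eq_zero_of_integral_contDiff_smul_eq_zero (μ := volume) ?_ ?_
  · exact locallyIntegrableOn_of_locallyIntegrable_restrict
      ((Lp.memLp _).locallyIntegrable (by norm_num))
  · intro φ h1 h2 h3
    have h := u.2 α φ ⟨h1, h2, h3⟩
    have hu' : (u : PiLp 2 fun _ : multiIdx d σ => L2 Ω) (zeroIdx d σ) = 0 := hu
    rw [hu', integral_zero_mul] at h
    have h' : ∫ x in Ω, (u : PiLp 2 fun _ : multiIdx d σ => L2 Ω) α x * φ x = 0 := by
      rcases mul_eq_zero.1 h.symm with h0 | h0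
      · exact absurd h0 (pow_ne_zero _ (by norm_num))
      · exact h0
    rw [← h', ← setIntegral_eq_integral_of_forall_compl_eq_zero (s := Ω)]
    · simp only [smul_eq_mul, mul_comm]
    · intro x hx
      rw [image_eq_zero_of_notMem_tsupport fun hx' => hx (h3 hx'), zero_smul]

/-- The bounded operator `K : H^σ(Y) → H^σ(X)` is the Koopman operator `f ↦ f ∘ A`,
irrespective of the representative chosen for the class of `f`. -/
def IsKoopman {d σ : ℕ} {X Y : Set (Euc d)} (A : Euc d → Euc d)
    (K : SobolevH σ Y →L[ℝ] SobolevH σ X) : Prop :=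
  ∀ (u : SobolevH σ Y) (f : Euc d → ℝ), f =ᵐ[volume.restrict Y] sobFn u →
    (fun x => f (A x)) =ᵐ[volume.restrict X] sobFn (K u)

/-! ### The constants -/

/-- `c₀ = sup_{x ∈ Ω} |det DA(x)|⁻¹`. -/
def c0 {d : ℕ} (A : Euc d → Euc d) (Ω : Set (Euc d)) : ℝ := ⨆ x : Ω, (absDet A x)⁻¹

/-- The Faà di Bruno coefficient
`∑_{π ∈ Π_m, |π| = |α'|} ∑_{β' ∈ P(α')} ∏_i ∂_{β,B_i} A_{β'_i}(x)`.
`OrderedFinpartition m` is the type of partitions `π` of an `m`-element set, the blocks `B_i` being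
listed in a fixed order and parametrized increasingly by `π.emb i`. -/
def faaCoeff {d m : ℕ} (A : Euc d → Euc d) (β : Fin m → Fin d) (α' : Fin d → ℕ)
    (x : Euc d) : ℝ :=
  open Classical in
  ∑ π : OrderedFinpartition m with π.length = ∑ i, α' i,
    ∑ β' : Fin π.length → Fin d with IsArrangement α' β',
      ∏ i, partialDeriv (fun r => β (π.emb i r)) (fun z => A z (β' i)) x

/-- The right-hand side in the definition of `S_α(A)`, for a given `β ∈ P(α)`, `m = |α|`. -/
def SArr {d m : ℕ} (A : Euc d → Euc d) (Ω : Set (Euc d)) (β : Fin m → Fin d) : ℝ :=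
  ⨆ x : Ω, (absDet A x)⁻¹ * ∑ k ∈ Finset.Icc 1 m,
    ∑ α' ∈ Finset.piAntidiag (Finset.univ : Finset (Fin d)) k, |faaCoeff A β α' x| ^ 2

/-- `S_α(A)`, computed with the non-decreasing `β ∈ P(α)`. -/
def S {d : ℕ} (A : Euc d → Euc d) (Ω : Set (Euc d)) (α : Fin d → ℕ) : ℝ :=
  SArr A Ω (stdArr α)

end KoopmanSobolev

end

open KoopmanSobolev

/-!
The Faà di Bruno formula writes `D^α (h ∘ A)` for smooth `h` as `∑ c_{α,α'} (D^α' h) ∘ A`, where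
the coefficients `c_{α,α'}` are the polynomials `faaCoeff` in the derivatives of `A`
(`partialDeriv_comp_eq_sum`). Once this is known for weak derivatives of `u ∈ H^σ(Y)`, the norm
estimate follows from the Cauchy-Schwarz inequality in the sum over `α'` and the change of variables
`y = A x`: the sum of the squares of the derivatives of `u ∘ A` is at most
`C |det DA| ∑ |D^α' u|² ∘ A` as soon as `C` dominates both `|det DA|⁻¹` and
`|det DA|⁻¹ ∑ c_{α,α'}²` (`sum_chainDeriv_sq_le`, `norm_koopmanLin_le`). Both constants of the
theorem do; for `σ = 1` the coefficients are the entries of the Jacobian matrix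
(`sum_faaCoeff_sq_eq_frobSq`).

The chain rule for weak derivatives (`integral_comp_mul_multiDeriv`) is proved by duality. For a
test function `φ` on `X`, integration by parts and the change of variables turn the classical
chain rule into the identity `∫ h w₀ = ± ∑ ∫ (D^α' h) w_α'` for all smooth `h`, where `w₀`
and `w_α'` are the images under `A` of `D^α φ` and `c_{α,α'} φ`. These are only continuous, with
compact support in `Y`. Convolving the identity with a smooth mollifier gives one between test
functions, in which `u` may be inserted by the definition of weak derivatives, and the mollified
functions converge (`integral_sobolev_mul_eq`).

The coefficients `c_{α,α'}` depend on the arrangement `β` of `α` only through `α`: applied to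
`h = exp ⟨ξ, ·⟩`, the formula shows that the polynomial `∑ c_{α,α'} ξ^α'` is
`exp(-⟨ξ, A x⟩) ∂_β exp⟨ξ, A ·⟩`, and iterated derivatives of a `C^n` function are symmetric
(`iteratedFDeriv_comp_perm`, `faaCoeff_eq_of_isArrangement`).
-/

open KoopmanSobolev

namespace KoopmanSobolev

/-! ### Symmetry of iterated derivatives -/

section Symmetry

variable {E F : Type*} [NormedAddCommGroup E] [NormedSpace ℝ E]
  [NormedAddCommGroup F] [NormedSpace ℝ F]

/-- Two adjacent directions of an iterated derivative may be interchanged. For the first two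
directions this is the symmetry of the second derivative, applied to a derivative of order `n - 1`;
otherwise the interchange takes place in the derivative of order `n` near `x`. -/
theorem iteratedFDeriv_comp_swap {n : ℕ} {f : E → F} {x : E} (hf : ContDiffAt ℝ (n + 1 : ℕ) f x)
    (i : Fin n) (v : Fin (n + 1) → E) :
    iteratedFDeriv ℝ (n + 1) f x (v ∘ Equiv.swap i.castSucc i.succ) =
      iteratedFDeriv ℝ (n + 1) f x v := by
  induction n generalizing x with
  | zero => exact i.elim0
  | succ n ih =>
    have hd : DifferentiableAt ℝ (iteratedFDeriv ℝ (n + 1) f) x :=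
      hf.differentiableAt_iteratedFDeriv (by exact_mod_cast Nat.lt_succ_self _)
    rw [hd.iteratedFDeriv_succ_apply_left', hd.iteratedFDeriv_succ_apply_left']
    induction i using Fin.cases with
    | zero =>
      have hev : ∀ᶠ y in 𝓝 x, ContDiffAt ℝ (n + 1 + 1 : ℕ) f y := hf.eventually (by simp)
      have key : ∀ w : Fin (n + 1) → E,
          (fun y => iteratedFDeriv ℝ (n + 1) f y w) =ᶠ[𝓝 x]
            fun y => fderiv ℝ (fun z => iteratedFDeriv ℝ n f z (Fin.tail w)) y (w 0) := by
        intro w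
        filter_upwards [hev] with y hy
        have hlt : ((n : ℕ) : WithTop ℕ∞) < (n + 1 + 1 : ℕ) := by
          exact_mod_cast Nat.lt_succ_of_lt (Nat.lt_succ_self _)
        exact (hy.differentiableAt_iteratedFDeriv hlt).iteratedFDeriv_succ_apply_left'
      rw [(key _).fderiv_eq, (key _).fderiv_eq]
      set g : E → F := fun z => iteratedFDeriv ℝ n f z (Fin.tail (Fin.tail v)) with hg
      have ht : Fin.tail (Fin.tail (v ∘ Equiv.swap (Fin.castSucc (0 : Fin (n + 1)))
          (Fin.succ (0 : Fin (n + 1))))) = Fin.tail (Fin.tail v) := by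
        ext j
        simp only [Fin.tail, Function.comp]
        rw [Equiv.swap_apply_of_ne_of_ne]
        · simp
        · simp [Fin.ext_iff]
      have hgC : ContDiffAt ℝ 2 g x := by
        have h1 : ContDiffAt ℝ 2 (iteratedFDeriv ℝ n f) x :=
          hf.iteratedFDeriv_right (by norm_cast; omega)
        exact (ContinuousMultilinearMap.apply ℝ (fun _ : Fin n => E) F
          (Fin.tail (Fin.tail v))).contDiff.contDiffAt.comp x h1
      have hdg : DifferentiableAt ℝ (fderiv ℝ g) x :=
        (hgC.fderiv_right (m := 1) (by norm_num)).differentiableAt (by norm_num)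
      have hs : IsSymmSndFDerivAt ℝ g x := hgC.isSymmSndFDerivAt (by simp)
      rw [ht]
      simp only [← hg]
      have e : ∀ a b : E, fderiv ℝ (fun y => fderiv ℝ g y a) x b = fderiv ℝ (fderiv ℝ g) x b a := by
        intro a b
        rw [fderiv_clm_apply hdg (differentiableAt_const _)]
        simp
      rw [e, e]
      have s1 : (v ∘ Equiv.swap (Fin.castSucc (0 : Fin (n + 1))) (Fin.succ (0 : Fin (n + 1)))) 0
          = v 1 := by
        simp
      have s2 : Fin.tail (v ∘ Equiv.swap (Fin.castSucc (0 : Fin (n + 1)))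
          (Fin.succ (0 : Fin (n + 1)))) 0 = v 0 := by
        simp [Fin.tail]
      rw [s1, s2]
      exact hs _ _
    | succ j =>
      have hev : ∀ᶠ y in 𝓝 x, ContDiffAt ℝ (n + 1 : ℕ) f y :=
        (hf.of_le (by norm_cast; omega)).eventually (by simp)
      have h0 : (v ∘ Equiv.swap (Fin.castSucc j.succ) (Fin.succ j.succ)) 0 = v 0 := by
        rw [Function.comp_apply, Equiv.swap_apply_of_ne_of_ne]
        · simp [Fin.ext_iff]
        · simp [Fin.ext_iff]
      have ht : Fin.tail (v ∘ Equiv.swap (Fin.castSucc j.succ) (Fin.succ j.succ)) =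
          Fin.tail v ∘ Equiv.swap j.castSucc j.succ := by
        ext k
        simp only [Fin.tail, Function.comp]
        refine congrArg v ?_
        rw [← Fin.succ_castSucc]
        exact (Function.Injective.map_swap (Fin.succ_injective _) _ _ _).symm
      have heq : (fun y => iteratedFDeriv ℝ (n + 1) f y
          (Fin.tail v ∘ Equiv.swap j.castSucc j.succ)) =ᶠ[𝓝 x]
          fun y => iteratedFDeriv ℝ (n + 1) f y (Fin.tail v) := by
        filter_upwards [hev] with y hy
        exact ih hy j _
      rw [h0, ht, heq.fderiv_eq]

/-- The `n`-th derivative of a real function of class `C^n` is symmetric. -/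
theorem iteratedFDeriv_comp_perm {n : ℕ} {f : E → F} {x : E} (hf : ContDiffAt ℝ n f x)
    (v : Fin n → E) (e : Equiv.Perm (Fin n)) :
    iteratedFDeriv ℝ n f x (v ∘ e) = iteratedFDeriv ℝ n f x v := by
  cases n with
  | zero => congr 1; exact Subsingleton.elim _ _
  | succ n =>
    have he : e ∈ Submonoid.closure
        (Set.range fun i : Fin n => Equiv.swap i.castSucc i.succ) := by
      rw [Equiv.Perm.mclosure_swap_castSucc_succ]; trivial
    induction he using Submonoid.closure_induction generalizing v with
    | mem e he =>
      obtain ⟨i, rfl⟩ := he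
      exact iteratedFDeriv_comp_swap hf i v
    | one => rfl
    | mul a b _ _ ha hb =>
      rw [Equiv.Perm.coe_mul, ← Function.comp_assoc, hb, ha]

end Symmetry

/-! ### Partial derivatives and the Faà di Bruno coefficients -/

section Partial

variable {d n : ℕ}

theorem IsArrangement.sum_eq {α : Fin d → ℕ} {β : Fin n → Fin d} (h : IsArrangement α β) :
    ∑ i, α i = n := by
  have := Finset.card_eq_sum_card_fiberwise (f := β) (s := Finset.univ) (t := Finset.univ)
    (fun _ _ => Finset.mem_coe.2 (Finset.mem_univ _))
  rw [Finset.card_univ, Fintype.card_fin] at this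
  rw [this]
  exact Finset.sum_congr rfl fun k _ => (h k).symm

/-- Two arrangements of the same multi-index differ by a permutation. -/
theorem IsArrangement.exists_perm {α : Fin d → ℕ} {β γ : Fin n → Fin d}
    (hβ : IsArrangement α β) (hγ : IsArrangement α γ) : ∃ e : Equiv.Perm (Fin n), γ ∘ e = β := by
  have h : ∀ k, Nonempty ({a // β a = k} ≃ {b // γ b = k}) := by
    intro k
    refine Fintype.card_eq.1 ?_
    rw [Fintype.card_subtype, Fintype.card_subtype, hβ k, hγ k]
  exact ⟨Equiv.ofFiberEquiv fun k => (h k).some,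
    funext fun a => Equiv.ofFiberEquiv_map (fun k => (h k).some) a⟩

theorem partialDeriv_eq_of_isArrangement {α : Fin d → ℕ} {β γ : Fin n → Fin d}
    (hβ : IsArrangement α β) (hγ : IsArrangement α γ) {g : Euc d → ℝ} {x : Euc d}
    (hg : ContDiffAt ℝ n g x) : partialDeriv β g x = partialDeriv γ g x := by
  obtain ⟨e, rfl⟩ := hβ.exists_perm hγ
  exact iteratedFDeriv_comp_perm hg (fun r => stdVec (γ r)) e

theorem IsArrangement.partialDeriv_eq {α : Fin d → ℕ} {β : Fin n → Fin d}
    (hβ : IsArrangement α β) {g : Euc d → ℝ} {x : Euc d}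
    (hg : ContDiffAt ℝ n g x) : partialDeriv β g x = multiDeriv α g x := by
  obtain rfl := hβ.sum_eq
  exact partialDeriv_eq_of_isArrangement hβ (isArrangement_stdArr α) hg

theorem partialDeriv_comp_apply {β : Fin n → Fin d} {A : Euc d → Euc d} {x : Euc d}
    (hA : ContDiffAt ℝ n A x) (k : Fin d) :
    partialDeriv β (fun z => A z k) x = iteratedFDeriv ℝ n A x (fun r => stdVec (β r)) k := by
  have := (EuclideanSpace.proj (𝕜 := ℝ) k).iteratedFDeriv_comp_left hA le_rfl
  unfold partialDeriv
  change iteratedFDeriv ℝ n ((EuclideanSpace.proj (𝕜 := ℝ) k) ∘ A) x _ = _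
  rw [this]
  rfl

theorem Euc.eq_sum_smul (v : Euc d) : v = ∑ k, v k • stdVec k := by
  simpa using ((EuclideanSpace.basisFun (Fin d) ℝ).sum_repr v).symm

theorem isArrangement_count (β : Fin n → Fin d) :
    IsArrangement (fun k => (Finset.univ.filter fun j => β j = k).card) β := fun _ => rfl

/-- The Faà di Bruno formula for partial derivatives, in which the terms are grouped according to
the derivative `D^α' h` of the outer function. -/
theorem partialDeriv_comp_eq_sum {σ : ℕ} (hn : n ≤ σ) {β : Fin n → Fin d} {A : Euc d → Euc d}
    {h : Euc d → ℝ} {x : Euc d} (hA : ContDiffAt ℝ n A x) (hh : ContDiffAt ℝ n h (A x)) :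
    partialDeriv β (fun z => h (A z)) x =
      ∑ α' ∈ multiIdx d σ, faaCoeff A β α' x * multiDeriv α' h (A x) := by
  classical
  -- expand `D^n (h ∘ A)` by multilinearity in the standard basis
  have hexpand : partialDeriv β (fun z => h (A z)) x = ∑ π : OrderedFinpartition n,
      ∑ β' : Fin π.length → Fin d,
        (∏ i, partialDeriv (fun r => β (π.emb i r)) (fun z => A z (β' i)) x) *
          partialDeriv β' h (A x) := by
    have h1 := iteratedFDeriv_comp hh hA le_rfl
    unfold partialDeriv
    change iteratedFDeriv ℝ n (h ∘ A) x _ = _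
    rw [h1, FormalMultilinearSeries.taylorComp, sum_apply]
    refine Finset.sum_congr rfl fun π _ => ?_
    rw [FormalMultilinearSeries.compAlongOrderedFinpartition_apply]
    have e : π.applyOrderedFinpartition (fun m => ftaylorSeries ℝ A x (π.partSize m))
        (fun r => stdVec (β r)) = fun i => ∑ k,
        partialDeriv (fun r => β (π.emb i r)) (fun z => A z k) x • stdVec k := by
      ext1 i
      rw [OrderedFinpartition.applyOrderedFinpartition_apply]
      refine (Euc.eq_sum_smul (ftaylorSeries ℝ A x (π.partSize i) _)).trans ?_
      refine Finset.sum_congr rfl fun k _ => ?_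
      rw [partialDeriv_comp_apply (hA.of_le (by exact_mod_cast π.partSize_le i))]
      rfl
    rw [e, ContinuousMultilinearMap.map_sum]
    refine Finset.sum_congr rfl fun β' _ => ?_
    rw [ContinuousMultilinearMap.map_smul_univ, smul_eq_mul]
    rfl
  -- the condition `|π| = |α'|` in the coefficient is implied by `β' ∈ P(α')`
  have hcoeff_eq : ∀ α', faaCoeff A β α' x = ∑ π : OrderedFinpartition n,
      ∑ β' : Fin π.length → Fin d, if IsArrangement α' β' then
        ∏ i, partialDeriv (fun r => β (π.emb i r)) (fun z => A z (β' i)) x else 0 := by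
    intro α'
    unfold faaCoeff
    rw [Finset.sum_filter]
    refine Finset.sum_congr rfl fun π _ => ?_
    split_ifs with hπ
    · rw [Finset.sum_filter]
    · symm
      refine Finset.sum_eq_zero fun β' _ => if_neg fun hβ' => hπ hβ'.sum_eq.symm
  rw [hexpand]
  simp only [hcoeff_eq, Finset.sum_mul]
  rw [Finset.sum_comm]
  refine Finset.sum_congr rfl fun π _ => ?_
  rw [Finset.sum_comm]
  refine Finset.sum_congr rfl fun β' _ => ?_
  have hc := isArrangement_count β'
  rw [Finset.sum_eq_single_of_mem _ (mem_multiIdx.2 ((hc.sum_eq.trans_le π.length_le).trans hn))]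
  · rw [if_pos hc, hc.partialDeriv_eq (hh.of_le (by exact_mod_cast π.length_le))]
  · intro α' _ hne
    rw [if_neg, zero_mul]
    intro h'
    exact hne (funext fun k => (h' k).symm)

/-- There are no partitions with more blocks than elements. -/
theorem faaCoeff_eq_zero_of_lt {α' : Fin d → ℕ} (h : n < ∑ i, α' i) (A : Euc d → Euc d)
    (β : Fin n → Fin d) (x : Euc d) : faaCoeff A β α' x = 0 := by
  unfold faaCoeff
  rw [Finset.sum_filter]
  refine Finset.sum_eq_zero fun π _ => if_neg fun h' => ?_
  have := π.length_le
  omega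

/-- A partition of a non-empty set has at least one block. -/
theorem faaCoeff_zero_right (hn : 0 < n) (A : Euc d → Euc d)
    (β : Fin n → Fin d) (x : Euc d) : faaCoeff A β 0 x = 0 := by
  unfold faaCoeff
  rw [Finset.sum_filter]
  refine Finset.sum_eq_zero fun π _ => if_neg fun h' => ?_
  have := π.length_pos hn
  simp at h'
  omega

theorem faaCoeff_zero_zero (hn : n = 0) (A : Euc d → Euc d)
    (β : Fin n → Fin d) (x : Euc d) : faaCoeff A β 0 x = 1 := by
  classical
  subst hn
  unfold faaCoeff
  have hl : ∀ π : OrderedFinpartition 0, π.length = 0 := fun π => Nat.le_zero.1 π.length_le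
  rw [Finset.filter_true_of_mem (fun π _ => by simp [hl π])]
  rw [Fintype.sum_unique]
  have : IsEmpty (Fin (default : OrderedFinpartition 0).length) := by
    rw [hl]; infer_instance
  rw [Finset.filter_true_of_mem]
  · simp
  · intro β' _ k
    simp

theorem isArrangement_single (β : Fin 1 → Fin d) (j : Fin d) :
    IsArrangement (Pi.single j 1) β ↔ β 0 = j := by
  constructor
  · intro h
    by_contra hne
    have := h j
    rw [Finset.filter_false_of_mem (by intro r _; rwa [Subsingleton.elim r 0])] at this
    simp at this
  · rintro rfl k
    by_cases hk : β 0 = k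
    · subst hk
      rw [Finset.filter_true_of_mem (by intro r _; rw [Subsingleton.elim r 0])]
      simp
    · rw [Finset.filter_false_of_mem (by intro r _; rwa [Subsingleton.elim r 0])]
      simp [Ne.symm hk]

/-- For derivatives of first order the Faà di Bruno coefficients are the entries of the Jacobian
matrix. -/
theorem faaCoeff_single (hn : n = 1) {A : Euc d → Euc d} (β : Fin n → Fin d) {x : Euc d}
    (hA : ContDiffAt ℝ 1 A x) {i : Fin d} (hβ : IsArrangement (Pi.single i 1) β) (j : Fin d) :
    faaCoeff A β (Pi.single j 1) x = fderiv ℝ A x (stdVec i) j := by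
  classical
  subst hn
  rw [isArrangement_single] at hβ
  unfold faaCoeff
  rw [Finset.sum_filter, Fintype.sum_subsingleton _ (OrderedFinpartition.atomic 1),
    if_pos (by simp)]
  change ∑ β' : Fin 1 → Fin d with IsArrangement (Pi.single j 1) β', ∏ i : Fin 1,
    partialDeriv (fun _ : Fin 1 => β i) (fun z => A z (β' i)) x = _
  rw [Finset.sum_eq_single_of_mem (fun _ => j)]
  · rw [Fintype.prod_subsingleton _ 0, partialDeriv_comp_apply hA, iteratedFDeriv_one_apply, hβ]
  · simp [isArrangement_single]
  · intro β' h1 h2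
    refine absurd (funext fun r => ?_) h2
    rw [Subsingleton.elim r 0]
    simpa [isArrangement_single] using h1

theorem IsArrangement.prod_comp {α : Fin d → ℕ} {β : Fin n → Fin d} (h : IsArrangement α β)
    (ξ : Fin d → ℝ) : ∏ r, ξ (β r) = ∏ k, ξ k ^ α k := by
  rw [← Finset.prod_fiberwise' Finset.univ β ξ]
  refine Finset.prod_congr rfl fun k _ => ?_
  rw [Finset.prod_const, h k]

theorem multiDeriv_exp_inner (α : Fin d → ℕ) (ξ y : Euc d) :
    multiDeriv α (fun z => Real.exp (inner ℝ ξ z)) y =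
      (∏ k, ξ k ^ α k) * Real.exp (inner ℝ ξ y) := by
  have h := (innerSL ℝ ξ).iteratedFDeriv_comp_right (n := (∑ i, α i : ℕ)) Real.contDiff_exp y le_rfl
  unfold multiDeriv partialDeriv
  change iteratedFDeriv ℝ _ (Real.exp ∘ (innerSL ℝ ξ)) y _ = _
  rw [h, ContinuousMultilinearMap.compContinuousLinearMap_apply,
    iteratedFDeriv_apply_eq_iteratedDeriv_mul_prod, ← (isArrangement_stdArr α).prod_comp,
    smul_eq_mul, iteratedDeriv_eq_iterate, Real.iter_deriv_exp]
  refine congrArg₂ _ (Finset.prod_congr rfl fun r _ => ?_) rfl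
  simp [EuclideanSpace.inner_single_right]

/-- The Faà di Bruno coefficients depend only on how often each direction occurs in `β`. They are
the coefficients of the polynomial `ξ ↦ exp(-⟨ξ, A x⟩) ∂_β exp(⟨ξ, A ·⟩)(x)`, and iterated
derivatives are symmetric. -/
theorem faaCoeff_eq_of_isArrangement {α : Fin d → ℕ} {β γ : Fin n → Fin d}
    (hβ : IsArrangement α β) (hγ : IsArrangement α γ) {A : Euc d → Euc d} {x : Euc d}
    (hA : ContDiffAt ℝ n A x) (α' : Fin d → ℕ) : faaCoeff A β α' x = faaCoeff A γ α' x := by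
  classical
  by_cases hα' : ∑ i, α' i ≤ n
  swap
  · rw [faaCoeff_eq_zero_of_lt (not_le.1 hα'), faaCoeff_eq_zero_of_lt (not_le.1 hα')]
  let P : (Fin n → Fin d) → MvPolynomial (Fin d) ℝ := fun β => ∑ α' ∈ multiIdx d n,
    MvPolynomial.monomial (Finsupp.equivFunOnFinite.symm α') (faaCoeff A β α' x)
  have hcoeff : ∀ β, (P β).coeff (Finsupp.equivFunOnFinite.symm α') = faaCoeff A β α' x := by
    intro β
    simp only [P, MvPolynomial.coeff_sum, MvPolynomial.coeff_monomial,
      Finsupp.equivFunOnFinite.symm.injective.eq_iff]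
    rw [Finset.sum_ite_eq', if_pos (mem_multiIdx.2 hα')]
  have heval : ∀ β (ξ : Fin d → ℝ), MvPolynomial.eval ξ (P β) *
      Real.exp (inner ℝ (WithLp.toLp 2 ξ : Euc d) (A x)) =
        partialDeriv β (fun z => Real.exp (inner ℝ (WithLp.toLp 2 ξ : Euc d) (A z))) x := by
    intro β ξ
    have hh : ContDiffAt ℝ n (fun z => Real.exp (inner ℝ (WithLp.toLp 2 ξ : Euc d) z)) (A x) :=
      Real.contDiff_exp.contDiffAt.comp _ (contDiffAt_const.inner ℝ contDiffAt_id)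
    rw [partialDeriv_comp_eq_sum le_rfl hA hh, map_sum, Finset.sum_mul]
    refine Finset.sum_congr rfl fun α'' _ => ?_
    rw [multiDeriv_exp_inner, MvPolynomial.eval_monomial, ← mul_assoc,
      Finsupp.prod_fintype _ _ (by simp)]
    rfl
  suffices hP : P β = P γ by rw [← hcoeff β, ← hcoeff γ, hP]
  refine MvPolynomial.funext fun ξ => ?_
  refine mul_right_cancel₀ (Real.exp_ne_zero (inner ℝ (WithLp.toLp 2 ξ : Euc d) (A x))) ?_
  rw [heval, heval]
  refine partialDeriv_eq_of_isArrangement hβ hγ ?_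
  exact Real.contDiff_exp.contDiffAt.comp x (contDiffAt_const.inner ℝ hA)

/-- `S_α(A)` does not depend on the arrangement `β` of `α`. -/
theorem SArr_eq_S {X : Set (Euc d)} (hX : IsOpen X) {A : Euc d → Euc d} {α : Fin d → ℕ}
    (hA : ContDiffOn ℝ (∑ i, α i : ℕ) A X) {β : Fin (∑ i, α i) → Fin d} (hβ : IsArrangement α β) :
    SArr A X β = S A X α := by
  unfold S SArr
  refine iSup_congr fun x => congrArg _ <|
    Finset.sum_congr rfl fun k _ => Finset.sum_congr rfl fun α' _ => ?_
  rw [faaCoeff_eq_of_isArrangement hβ (isArrangement_stdArr α)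
    (hA.contDiffAt (hX.mem_nhds x.2))]

/-! ### Continuity and bounds for the coefficients -/

theorem continuousOn_partialDeriv {X : Set (Euc d)} (hX : IsOpen X) {g : Euc d → ℝ}
    (hg : ContDiffOn ℝ n g X) (β : Fin n → Fin d) : ContinuousOn (partialDeriv β g) X := by
  have h1 : ContinuousOn (iteratedFDeriv ℝ n g) X :=
    (hg.continuousOn_iteratedFDerivWithin le_rfl hX.uniqueDiffOn).congr
      fun x hx => ((iteratedFDerivWithin_of_isOpen n hX) hx).symm
  exact (ContinuousMultilinearMap.apply ℝ _ ℝ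
    (fun r => stdVec (β r))).continuous.comp_continuousOn h1

theorem continuousOn_faaCoeff {X : Set (Euc d)} (hX : IsOpen X) {A : Euc d → Euc d}
    (hA : ContDiffOn ℝ n A X) (β : Fin n → Fin d) (α' : Fin d → ℕ) :
    ContinuousOn (faaCoeff A β α') X := by
  unfold faaCoeff
  refine continuousOn_finsetSum _ fun π _ => continuousOn_finsetSum _ fun β' _ =>
    continuousOn_finsetProd _ fun i _ => continuousOn_partialDeriv hX ?_ _
  exact (EuclideanSpace.proj (𝕜 := ℝ) (β' i)).contDiff.comp_contDiffOn
    (hA.of_le (by exact_mod_cast π.partSize_le i))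

theorem exists_bound_partialDeriv {X : Set (Euc d)} (hX : IsOpen X) {k : ℕ} {A : Euc d → Euc d}
    (hA : IsCb k A X) (hn : n ≤ k) (β : Fin n → Fin d) (i : Fin d) :
    ∃ M, ∀ x ∈ X, |partialDeriv β (fun z => A z i) x| ≤ M := by
  obtain ⟨M, hM⟩ := hA.2 n hn
  refine ⟨M, fun x hx => ?_⟩
  rw [partialDeriv_comp_apply ((hA.1.contDiffAt (hX.mem_nhds hx)).of_le (by exact_mod_cast hn))]
  refine (PiLp.norm_apply_le (iteratedFDeriv ℝ n A x fun r => stdVec (β r)) i).trans ?_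
  refine ((iteratedFDeriv ℝ n A x).le_opNorm _).trans ?_
  simpa using hM x hx

theorem exists_bound_faaCoeff {X : Set (Euc d)} (hX : IsOpen X) {k : ℕ} {A : Euc d → Euc d}
    (hA : IsCb k A X) (hn : n ≤ k) (β : Fin n → Fin d) (α' : Fin d → ℕ) :
    ∃ M, ∀ x ∈ X, |faaCoeff A β α' x| ≤ M := by
  classical
  choose M hM using fun (π : OrderedFinpartition n) (i : Fin π.length) =>
    exists_bound_partialDeriv hX hA ((π.partSize_le i).trans hn) (fun r => β (π.emb i r))
  refine ⟨∑ π : OrderedFinpartition n with π.length = ∑ i, α' i,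
    ∑ β' : Fin π.length → Fin d with IsArrangement α' β', ∏ i, M π i (β' i), fun x hx => ?_⟩
  unfold faaCoeff
  refine (Finset.abs_sum_le_sum_abs _ _).trans (Finset.sum_le_sum fun π _ => ?_)
  refine (Finset.abs_sum_le_sum_abs _ _).trans ?_
  have h : ∀ β' : Fin π.length → Fin d,
      |∏ i, partialDeriv (fun r => β (π.emb i r)) (fun z => A z (β' i)) x| ≤ ∏ i, M π i (β' i) :=
    fun β' => (Finset.abs_prod _ _).trans_le
      (Finset.prod_le_prod (fun _ _ => abs_nonneg _) fun i _ => hM π i (β' i) x hx)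
  convert Finset.sum_le_sum fun β' _ => h β' using 2

end Partial

/-! ### Integration by parts -/

section Parts

variable {d n : ℕ}

theorem partialDeriv_succ_right {f : Euc d → ℝ} (hf : ContDiff ℝ (n + 1 : ℕ) f)
    (β : Fin (n + 1) → Fin d) (x : Euc d) :
    partialDeriv β f x =
      partialDeriv (Fin.init β) (fun y => fderiv ℝ f y (stdVec (β (Fin.last n)))) x := by
  have h := (ContinuousLinearMap.apply ℝ ℝ
    (stdVec (β (Fin.last n)) : Euc d)).iteratedFDeriv_comp_left (f := fderiv ℝ f) (x := x)
      (hf.fderiv_right (m := n) (by norm_cast)).contDiffAt le_rfl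
  unfold partialDeriv
  rw [iteratedFDeriv_succ_apply_right]
  change _ = iteratedFDeriv ℝ n ((ContinuousLinearMap.apply ℝ ℝ
    (stdVec (β (Fin.last n)) : Euc d)) ∘ fderiv ℝ f) x _
  rw [h]
  rfl

theorem IsTestFun.fderiv_apply {X : Set (Euc d)} {φ : Euc d → ℝ} (h : IsTestFun X φ) (e : Euc d) :
    IsTestFun X (fun x => fderiv ℝ φ x e) where
  contDiff := (h.contDiff.fderiv_right (m := ∞) (by simp)).clm_apply contDiff_const
  hasCompactSupport := h.hasCompactSupport.fderiv_apply ℝ e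
  tsupport_subset := (tsupport_fderiv_apply_subset ℝ e).trans h.tsupport_subset

/-- The product of a function that is continuous on an open set `X` and a continuous function
supported in `X` is continuous. -/
theorem continuous_mul_of_tsupport_subset {X : Set (Euc d)} (hX : IsOpen X) {f φ : Euc d → ℝ}
    (hf : ContinuousOn f X) (hφ : Continuous φ) (hs : tsupport φ ⊆ X) :
    Continuous fun x => f x * φ x := by
  refine continuous_of_tsupport fun x hx => ?_
  have hx' : x ∈ X := hs (tsupport_mul_subset_right hx)
  exact (hf.continuousAt (hX.mem_nhds hx')).mul hφ.continuousAt

theorem setIntegral_mul_of_tsupport_subset {X : Set (Euc d)} (f : Euc d → ℝ) {φ : Euc d → ℝ}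
    (hs : tsupport φ ⊆ X) : ∫ x in X, f x * φ x = ∫ x, f x * φ x :=
  setIntegral_eq_integral_of_forall_compl_eq_zero fun x hx => by
    rw [image_eq_zero_of_notMem_tsupport fun h => hx (hs h), mul_zero]

/-- Moving the last entry of `β` to the front gives another arrangement of the same multi-index. -/
theorem isArrangement_cons_last_init (β : Fin (n + 1) → Fin d) :
    IsArrangement (fun k => (Finset.univ.filter fun j => β j = k).card)
      (Fin.cons (β (Fin.last n)) (Fin.init β) : Fin (n + 1) → Fin d) := by
  intro k
  simp only [Finset.card_filter]
  rw [Fin.sum_univ_succ, Fin.sum_univ_castSucc]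
  simp [Fin.init, add_comm]

/-- Iterated integration by parts against a test function. -/
theorem integral_mul_partialDeriv {X : Set (Euc d)} (hX : IsOpen X) {F : Euc d → ℝ}
    (hF : ContDiffOn ℝ n F X) (β : Fin n → Fin d) {φ : Euc d → ℝ} (hφ : IsTestFun X φ) :
    ∫ x in X, F x * partialDeriv β φ x = (-1) ^ n * ∫ x in X, partialDeriv β F x * φ x := by
  induction n generalizing φ with
  | zero => simp [partialDeriv]
  | succ n ih =>
    set e : Euc d := stdVec (β (Fin.last n))
    have hφ' := hφ.fderiv_apply e
    have hFn : ContDiffOn ℝ n F X := hF.of_le (by norm_cast; omega)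
    have h1 : ∀ x, partialDeriv β φ x =
        partialDeriv (Fin.init β) (fun y => fderiv ℝ φ y e) x := fun x =>
      partialDeriv_succ_right (hφ.contDiff.of_le (by exact_mod_cast le_top)) β x
    simp only [h1]
    rw [ih hFn _ hφ']
    set G : Euc d → ℝ := partialDeriv (Fin.init β) F
    have hGd : ∀ x ∈ X, DifferentiableAt ℝ G x ∧ fderiv ℝ G x e = partialDeriv β F x := by
      intro x hx
      have hFx := hF.contDiffAt (hX.mem_nhds hx)
      have hd : DifferentiableAt ℝ (iteratedFDeriv ℝ n F) x :=
        hFx.differentiableAt_iteratedFDeriv (by exact_mod_cast Nat.lt_succ_self n)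
      constructor
      · exact (ContinuousMultilinearMap.apply ℝ (fun _ : Fin n => Euc d) ℝ
          (fun r => stdVec (Fin.init β r))).differentiableAt.comp x hd
      · rw [partialDeriv_eq_of_isArrangement (isArrangement_count β)
          (isArrangement_cons_last_init β) hFx]
        unfold partialDeriv
        rw [hd.iteratedFDeriv_succ_apply_left']
        rfl
    have hGc : ContinuousOn G X := continuousOn_partialDeriv hX hFn _
    have hG'c : ContinuousOn (fun x => fderiv ℝ G x e) X :=
      (continuousOn_partialDeriv hX hF β).congr fun x hx => (hGd x hx).2
    have hint : ∀ (f ψ : Euc d → ℝ), ContinuousOn f X → IsTestFun X ψ →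
        Integrable fun x => f x * ψ x := fun f ψ hf hψ =>
      (continuous_mul_of_tsupport_subset hX hf hψ.contDiff.continuous
        hψ.tsupport_subset).integrable_of_hasCompactSupport hψ.hasCompactSupport.mul_left
    have hparts := integral_mul_fderiv_eq_neg_fderiv_mul_of_integrable (μ := volume)
      (hint _ _ hG'c hφ) (hint _ _ hGc hφ') (hint _ _ hGc hφ)
      (fun x hx => (hGd x (hφ.tsupport_subset hx)).1)
      (fun x _ => hφ.contDiff.differentiable (by simp) x)
    rw [setIntegral_mul_of_tsupport_subset _ hφ'.tsupport_subset, hparts,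
      ← setIntegral_mul_of_tsupport_subset _ hφ.tsupport_subset,
      setIntegral_congr_fun hX.measurableSet
        (fun x hx => by rw [(hGd x hx).2] : EqOn _ (fun x => partialDeriv β F x * φ x) X)]
    ring

end Parts

/-! ### Testing a distributional identity with Sobolev functions -/

section Mollification

open scoped Convolution
open ContinuousLinearMap (lsmul)

variable {d n : ℕ}

theorem isTestFun_univ_iff {φ : Euc d → ℝ} :
    IsTestFun univ φ ↔ ContDiff ℝ ∞ φ ∧ HasCompactSupport φ :=
  ⟨fun h => ⟨h.1, h.2⟩, fun h => ⟨h.1, h.2, subset_univ _⟩⟩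

/-- Partial derivatives of a convolution may be put on the smooth factor. -/
theorem partialDeriv_convolution {ρ w : Euc d → ℝ} (hρ : IsTestFun univ ρ) (hw : Continuous w)
    (β : Fin n → Fin d) (y : Euc d) :
    partialDeriv β (ρ ⋆[lsmul ℝ ℝ, volume] w) y = (partialDeriv β ρ ⋆[lsmul ℝ ℝ, volume] w) y := by
  induction n generalizing ρ with
  | zero => simp [partialDeriv]; rfl
  | succ n ih =>
    have hC : ContDiff ℝ ∞ (ρ ⋆[lsmul ℝ ℝ, volume] w) :=
      hρ.hasCompactSupport.contDiff_convolution_left _ hρ.contDiff hw.locallyIntegrable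
    rw [partialDeriv_succ_right (hC.of_le (by exact_mod_cast le_top))]
    have h1 : ∀ x, partialDeriv β ρ x =
        partialDeriv (Fin.init β) (fun y => fderiv ℝ ρ y (stdVec (β (Fin.last n)))) x := fun x =>
      partialDeriv_succ_right (hρ.contDiff.of_le (by exact_mod_cast le_top)) β x
    rw [show partialDeriv β ρ = _ from funext h1, ← ih (hρ.fderiv_apply _)]
    congr 1
    funext z
    have h2 := hρ.hasCompactSupport.hasFDerivAt_convolution_left (lsmul ℝ ℝ)
      (hρ.contDiff.of_le (by simp)) hw.locallyIntegrable (μ := volume) z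
    rw [h2.fderiv]
    have h3 : ConvolutionExistsAt (fderiv ℝ ρ) w z ((lsmul ℝ ℝ).precompL (Euc d)) volume :=
      (hρ.hasCompactSupport.fderiv ℝ).convolutionExists_left _
        (hρ.contDiff.continuous_fderiv (by simp)) hw.locallyIntegrable z
    exact ContinuousLinearMap.integral_apply h3 _

/-- Differentiating `z ↦ ρ (y - z)` instead of `ρ` costs the sign `(-1)^n`. -/
theorem partialDeriv_comp_const_sub {ρ : Euc d → ℝ} (hρ : ContDiff ℝ ∞ ρ) (β : Fin n → Fin d)
    (y z : Euc d) :
    partialDeriv β (fun z => ρ (y - z)) z = (-1) ^ n * partialDeriv β ρ (y - z) := by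
  have h := (-ContinuousLinearMap.id ℝ (Euc d)).iteratedFDeriv_comp_right
    (f := fun z => ρ (z + y)) (n := n) (hρ.comp (contDiff_id.add contDiff_const) |>.of_le
      (by exact_mod_cast le_top)) z le_rfl
  unfold partialDeriv
  have e : (fun z => ρ (y - z)) =
      (fun z => ρ (z + y)) ∘ (-ContinuousLinearMap.id ℝ (Euc d)) := by
    funext z
    simp [neg_add_eq_sub]
  rw [e, h, iteratedFDeriv_comp_add_right,
    ContinuousMultilinearMap.compContinuousLinearMap_apply]
  have e2 : (fun i : Fin n => (-ContinuousLinearMap.id ℝ (Euc d)) (stdVec (β i))) =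
      fun i => (-1 : ℝ) • stdVec (β i) := by
    funext i; simp
  rw [e2, ContinuousMultilinearMap.map_smul_univ]
  simp [neg_add_eq_sub]

/-- A continuous function with compact support in `Ω`. -/
structure IsContTestFun (Ω : Set (Euc d)) (w : Euc d → ℝ) : Prop where
  continuous : Continuous w
  hasCompactSupport : HasCompactSupport w
  tsupport_subset : tsupport w ⊆ Ω

/-- Convolution with a sufficiently concentrated bump function turns a continuous function with
compact support in `Ω` into a test function on `Ω`. -/
theorem IsContTestFun.exists_isTestFun_convolution {Ω : Set (Euc d)} (hΩ : IsOpen Ω)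
    {w : Euc d → ℝ} (hw : IsContTestFun Ω w) : ∃ δ > 0, ∀ ρ : ContDiffBump (0 : Euc d),
      ρ.rOut < δ → IsTestFun Ω (ρ.normed volume ⋆[lsmul ℝ ℝ, volume] w) := by
  obtain ⟨δ, hδ, hsub⟩ :=
    hw.hasCompactSupport.isCompact.exists_cthickening_subset_open hΩ hw.tsupport_subset
  refine ⟨δ, hδ, fun ρ hρ => ⟨?_, ?_, ?_⟩⟩
  · exact ρ.hasCompactSupport_normed.contDiff_convolution_left _ ρ.contDiff_normed
      hw.continuous.locallyIntegrable
  · exact ρ.hasCompactSupport_normed.convolution _ hw.hasCompactSupport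
  · refine Subset.trans (closure_minimal ?_ Metric.isClosed_cthickening) hsub
    refine (support_convolution_subset _).trans ?_
    rintro _ ⟨a, ha, b, hb, rfl⟩
    rw [ρ.support_normed_eq, mem_ball_zero_iff] at ha
    refine Metric.mem_cthickening_of_dist_le _ b _ _ (subset_tsupport _ hb) ?_
    simpa [dist_eq_norm] using (ha.trans hρ).le

/-- A sequence of bump functions shrinking to the origin. -/
noncomputable def shrinkingBump (d k : ℕ) : ContDiffBump (0 : Euc d) where
  rIn := 1 / (k + 1) / 2
  rOut := 1 / (k + 1)
  rIn_pos := by positivity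
  rIn_lt_rOut := half_lt_self (by positivity)

theorem tendsto_shrinkingBump_rOut (d : ℕ) :
    Filter.Tendsto (fun k => (shrinkingBump d k).rOut) Filter.atTop (𝓝 0) :=
  tendsto_one_div_add_atTop_nhds_zero_nat

/-- Mollifications of `w` converge to `w` weakly. -/
theorem tendsto_integral_mul_convolution {Ω : Set (Euc d)} {w : Euc d → ℝ}
    (hw : IsContTestFun Ω w) {u : Euc d → ℝ} (hu : IntegrableOn u Ω) :
    Filter.Tendsto (fun k => ∫ y in Ω, u y *
      ((shrinkingBump d k).normed volume ⋆[lsmul ℝ ℝ, volume] w) y) Filter.atTop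
      (𝓝 (∫ y in Ω, u y * w y)) := by
  obtain ⟨C, hC⟩ := hw.continuous.bounded_above_of_compact_support hw.hasCompactSupport
  refine tendsto_integral_of_dominated_convergence (fun y => ‖u y‖ * (3 * C)) ?_ ?_ ?_ ?_
  · intro k
    refine hu.aestronglyMeasurable.mul (Continuous.aestronglyMeasurable ?_)
    exact (shrinkingBump d k).hasCompactSupport_normed.continuous_convolution_left _
      (shrinkingBump d k).continuous_normed hw.continuous.locallyIntegrable
  · exact hu.norm.mul_const _
  · intro k
    refine Filter.Eventually.of_forall fun y => ?_
    rw [norm_mul]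
    gcongr
    -- the values of `w` differ by at most `2 * C`, hence so do `w` and its mollification
    have h := (shrinkingBump d k).dist_normed_convolution_le (x₀ := y) (ε := 2 * C) (μ := volume)
      hw.continuous.aestronglyMeasurable fun x _ => by
        rw [dist_eq_norm]
        refine (norm_sub_le _ _).trans ?_
        linarith [hC x, hC y]
    rw [dist_eq_norm] at h
    have h2 := norm_sub_norm_le
      (((shrinkingBump d k).normed volume ⋆[lsmul ℝ ℝ, volume] w) y) (w y)
    linarith [hC y]
  · refine Filter.Eventually.of_forall fun y => Filter.Tendsto.const_mul _ ?_
    exact ContDiffBump.convolution_tendsto_right_of_continuous (tendsto_shrinkingBump_rOut d)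
      hw.continuous y

/-- A distributional identity `w₀ = ∑_α (-1)^|α| s D^α w_α` between continuous compactly supported
functions, which by definition may be tested with smooth functions, may also be tested with
Sobolev functions. To see this, the `w_α` are mollified; then they are admissible in the
definition of the weak derivatives, and the mollified identity follows from the given one,
applied to translates of the mollifier. -/
theorem integral_sobolev_mul_eq {σ : ℕ} {Ω : Set (Euc d)} (hΩ : IsOpen Ω)
    (hb : Bornology.IsBounded Ω) {w₀ : Euc d → ℝ} {w : multiIdx d σ → Euc d → ℝ} {s : ℝ}
    (hw₀ : IsContTestFun Ω w₀) (hw : ∀ α, IsContTestFun Ω (w α))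
    (H : ∀ h : Euc d → ℝ, ContDiff ℝ ∞ h → ∫ y in Ω, h y * w₀ y =
      s * ∑ α : multiIdx d σ, ∫ y in Ω, multiDeriv α h y * w α y) (u : SobolevH σ Ω) :
    ∫ y in Ω, sobFn u y * w₀ y =
      s * ∑ α, ∫ y in Ω, (u : PiLp 2 fun _ : multiIdx d σ => L2 Ω) α y * w α y := by
  have : IsFiniteMeasure ((volume : Measure (Euc d)).restrict Ω) :=
    ⟨by rw [Measure.restrict_apply_univ]; exact hb.measure_lt_top⟩
  have hint : ∀ f : L2 Ω, IntegrableOn f Ω := fun f => (Lp.memLp f).integrable (by norm_num)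
  have hl := tendsto_integral_mul_convolution hw₀ (hint (sobFn u))
  have hr := (tendsto_finsetSum Finset.univ fun α _ =>
    tendsto_integral_mul_convolution (hw α) (hint
      ((u : PiLp 2 fun _ : multiIdx d σ => L2 Ω) α))).const_mul s
  refine tendsto_nhds_unique_of_eventuallyEq hl hr ?_
  have hev : ∀ᶠ k in Filter.atTop, ∀ α, IsTestFun Ω
      ((shrinkingBump d k).normed volume ⋆[lsmul ℝ ℝ, volume] w α) := by
    refine Filter.eventually_all.2 fun α => ?_
    obtain ⟨δ, hδ, h⟩ := (hw α).exists_isTestFun_convolution hΩ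
    filter_upwards [(tendsto_shrinkingBump_rOut d).eventually_lt_const hδ] with k hk
    exact h _ hk
  filter_upwards [hev] with k hk
  set ρ := (shrinkingBump d k).normed (volume : Measure (Euc d))
  have hρ : IsTestFun univ ρ := isTestFun_univ_iff.2
    ⟨(shrinkingBump d k).contDiff_normed, (shrinkingBump d k).hasCompactSupport_normed⟩
  have hconv : ∀ (g v : Euc d → ℝ), IsContTestFun Ω v → ∀ y,
      (g ⋆[lsmul ℝ ℝ, volume] v) y = ∫ z in Ω, g (y - z) * v z := by
    intro g v hv y
    rw [setIntegral_mul_of_tsupport_subset (fun z => g (y - z)) hv.tsupport_subset]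
    rw [convolution_lsmul_swap]
    rfl
  -- test the given identity with `z ↦ ρ (y - z)`
  have key : ∀ y, (ρ ⋆[lsmul ℝ ℝ, volume] w₀) y = s * ∑ α : multiIdx d σ,
      (-1) ^ (∑ i, (α : Fin d → ℕ) i) *
        multiDeriv α (ρ ⋆[lsmul ℝ ℝ, volume] w α) y := by
    intro y
    rw [hconv _ _ hw₀, H (fun z => ρ (y - z)) (hρ.contDiff.comp (contDiff_const.sub contDiff_id))]
    congr 1
    refine Finset.sum_congr rfl fun α _ => ?_
    unfold multiDeriv
    rw [partialDeriv_convolution hρ (hw α).continuous, hconv _ _ (hw α), ← integral_const_mul]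
    refine integral_congr_ae (Filter.Eventually.of_forall fun z => ?_)
    simp only
    rw [partialDeriv_comp_const_sub hρ.contDiff, mul_assoc]
  have hmul : ∀ y, sobFn u y * (ρ ⋆[lsmul ℝ ℝ, volume] w₀) y = ∑ α : multiIdx d σ,
      s * ((-1) ^ (∑ i, (α : Fin d → ℕ) i) *
        (sobFn u y * multiDeriv α (ρ ⋆[lsmul ℝ ℝ, volume] w α) y)) := by
    intro y
    rw [key, Finset.mul_sum, Finset.mul_sum]
    exact Finset.sum_congr rfl fun α _ => by ring
  simp only [hmul]
  rw [integral_finsetSum, Finset.mul_sum]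
  · refine Finset.sum_congr rfl fun α _ => ?_
    rw [integral_const_mul, integral_const_mul]
    have := u.2 α _ (hk α)
    unfold sobFn
    rw [this, ← mul_assoc ((-1 : ℝ) ^ _), ← mul_pow]
    simp
  · intro α _
    exact (((Lp.memLp (sobFn u)).integrable_mul
      ((hk α).memLp_multiDeriv _)).const_mul _).const_mul _

end Mollification

/-! ### Change of variables -/

section ChangeOfVariables

variable {d : ℕ} {X Y : Set (Euc d)} {A : Euc d → Euc d}

theorem IsC1Diffeo.injOn (hA : IsC1Diffeo A X Y) : InjOn A X := by
  obtain ⟨B, -, -, hB, -⟩ := hA.exists_inverse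
  exact hB.injOn

theorem IsC1Diffeo.image_eq (hA : IsC1Diffeo A X Y) : A '' X = Y := by
  obtain ⟨B, hBm, -, -, hB⟩ := hA.exists_inverse
  exact (hA.mapsTo.image_subset).antisymm fun y hy => ⟨B y, hBm hy, hB hy⟩

theorem IsC1Diffeo.hasFDerivWithinAt (hA : IsC1Diffeo A X Y) (hX : IsOpen X) :
    ∀ x ∈ X, HasFDerivWithinAt A (fderiv ℝ A x) X x := fun x hx =>
  (((hA.contDiffOn.contDiffAt (hX.mem_nhds hx)).differentiableAt
    (by norm_num)).hasFDerivAt).hasFDerivWithinAt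

theorem IsC1Diffeo.continuousOn_absDet (hA : IsC1Diffeo A X Y) (hX : IsOpen X) :
    ContinuousOn (absDet A) X := by
  have h : ContinuousOn (fderiv ℝ A) X :=
    hA.contDiffOn.continuousOn_fderiv_of_isOpen hX le_rfl
  exact (ContinuousLinearMap.continuous_det.comp_continuousOn h).abs

theorem IsC1Diffeo.setIntegral_eq (hA : IsC1Diffeo A X Y) (hX : IsOpen X) (g : Euc d → ℝ) :
    ∫ y in Y, g y = ∫ x in X, absDet A x * g (A x) := by
  conv_lhs => rw [← hA.image_eq]
  exact integral_image_eq_integral_abs_det_fderiv_smul volume hX.measurableSet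
    (hA.hasFDerivWithinAt hX) hA.injOn g

theorem IsC1Diffeo.integrableOn_iff (hA : IsC1Diffeo A X Y) (hX : IsOpen X) (g : Euc d → ℝ) :
    IntegrableOn g Y ↔ IntegrableOn (fun x => absDet A x * g (A x)) X := by
  conv_lhs => rw [← hA.image_eq]
  exact integrableOn_image_iff_integrableOn_abs_det_fderiv_smul volume hX.measurableSet
    (hA.hasFDerivWithinAt hX) hA.injOn g

/-- `A` pulls null sets back to null sets, as its inverse is differentiable. -/
theorem IsC1Diffeo.ae_comp (hA : IsC1Diffeo A X Y) (hX : IsOpen X) (hY : IsOpen Y)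
    {p : Euc d → Prop} (hp : ∀ᵐ y ∂volume.restrict Y, p y) :
    ∀ᵐ x ∂volume.restrict X, p (A x) := by
  obtain ⟨B, -, hBd, hB, -⟩ := hA.exists_inverse
  rw [ae_restrict_iff' hY.measurableSet, ae_iff] at hp
  rw [ae_restrict_iff' hX.measurableSet, ae_iff]
  have hd : DifferentiableOn ℝ B {y | ¬(y ∈ Y → p y)} := by
    refine (hBd.differentiableOn (by norm_num)).mono fun y hy => ?_
    by_contra h
    exact hy fun h' => absurd h' h
  refine measure_mono_null ?_
    (addHaar_image_eq_zero_of_differentiableOn_of_addHaar_eq_zero volume hd hp)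
  intro x hx
  simp only [mem_ofPred_eq, Classical.not_imp] at hx
  refine ⟨A x, ?_, hB hx.1⟩
  simp only [mem_ofPred_eq, Classical.not_imp]
  exact ⟨hA.mapsTo hx.1, hx.2⟩

theorem IsC1Diffeo.aestronglyMeasurable_comp (hA : IsC1Diffeo A X Y) (hX : IsOpen X)
    (hY : IsOpen Y) {g : Euc d → ℝ} (hg : AEStronglyMeasurable g (volume.restrict Y)) :
    AEStronglyMeasurable (fun x => g (A x)) (volume.restrict X) := by
  have h1 : AEStronglyMeasurable (fun x => hg.mk g (A x)) (volume.restrict X) :=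
    hg.stronglyMeasurable_mk.aestronglyMeasurable.comp_aemeasurable
      (hA.contDiffOn.continuousOn.aemeasurable hX.measurableSet)
  refine h1.congr ?_
  filter_upwards [hA.ae_comp hX hY hg.ae_eq_mk] with x hx using hx.symm

/-- Composition with `A` preserves square integrability, since `|det DA|` is bounded below. -/
theorem IsC1Diffeo.memLp_comp (hA : IsC1Diffeo A X Y) (hX : IsOpen X) (hY : IsOpen Y)
    (hdet : ∃ c : ℝ, 0 < c ∧ ∀ x ∈ X, c ≤ absDet A x) {g : Euc d → ℝ}
    (hg : MemLp g 2 (volume.restrict Y)) : MemLp (fun x => g (A x)) 2 (volume.restrict X) := by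
  obtain ⟨c, hc, hcd⟩ := hdet
  have hm := hA.aestronglyMeasurable_comp hX hY hg.aestronglyMeasurable
  rw [memLp_two_iff_integrable_sq hm]
  have hi := (hA.integrableOn_iff hX _).1
    ((memLp_two_iff_integrable_sq hg.aestronglyMeasurable).1 hg)
  refine Integrable.mono' (hi.const_mul c⁻¹) (hm.pow 2) ?_
  filter_upwards [ae_restrict_mem hX.measurableSet] with x hx
  rw [Real.norm_of_nonneg (sq_nonneg _), ← mul_assoc]
  refine le_mul_of_one_le_left (sq_nonneg _) ?_
  rw [← div_eq_inv_mul, one_le_div hc]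
  exact hcd x hx

/-- The density, with respect to Lebesgue measure on `Y`, of the image under `A` of the signed
measure with density `ψ` on `X`. It is set to `0` outside `Y`. -/
noncomputable def transport (A : Euc d → Euc d) (X Y : Set (Euc d)) (ψ : Euc d → ℝ) : Euc d → ℝ :=
  Y.indicator fun y => ψ (Function.invFunOn A X y) / absDet A (Function.invFunOn A X y)

theorem IsC1Diffeo.integral_mul_transport (hA : IsC1Diffeo A X Y) (hX : IsOpen X)
    (hdet : ∃ c : ℝ, 0 < c ∧ ∀ x ∈ X, c ≤ absDet A x) (h ψ : Euc d → ℝ) :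
    ∫ y in Y, h y * transport A X Y ψ y = ∫ x in X, h (A x) * ψ x := by
  obtain ⟨c, hc, hcd⟩ := hdet
  rw [hA.setIntegral_eq hX]
  refine setIntegral_congr_fun hX.measurableSet fun x hx => ?_
  have h0 : absDet A x ≠ 0 := (hc.trans_le (hcd x hx)).ne'
  simp only [transport]
  rw [indicator_of_mem (hA.mapsTo hx), hA.injOn.leftInvOn_invFunOn hx]
  field_simp

theorem IsC1Diffeo.continuousOn_invFunOn (hA : IsC1Diffeo A X Y) :
    ContinuousOn (Function.invFunOn A X) Y := by
  obtain ⟨B, hBm, hBd, hBl, hBr⟩ := hA.exists_inverse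
  refine hBd.continuousOn.congr fun y hy => ?_
  conv_lhs => rw [← hBr hy]
  exact hA.injOn.leftInvOn_invFunOn (hBm hy)

theorem IsC1Diffeo.invFunOn_mem (hA : IsC1Diffeo A X Y) : MapsTo (Function.invFunOn A X) Y X := by
  intro y hy
  rw [← hA.image_eq] at hy
  exact Function.invFunOn_mem hy

/-- Only continuity survives the transport, because the Jacobian determinant of a `C¹` map is
merely continuous. -/
theorem IsC1Diffeo.isContTestFun_transport (hA : IsC1Diffeo A X Y) (hX : IsOpen X) (hY : IsOpen Y)
    (hdet : ∃ c : ℝ, 0 < c ∧ ∀ x ∈ X, c ≤ absDet A x) {ψ : Euc d → ℝ} (hψ : IsContTestFun X ψ) :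
    IsContTestFun Y (transport A X Y ψ) := by
  obtain ⟨c, hc, hcd⟩ := hdet
  have hK : IsCompact (A '' tsupport ψ) := hψ.hasCompactSupport.isCompact.image_of_continuousOn
    (hA.contDiffOn.continuousOn.mono hψ.tsupport_subset)
  have hKY : A '' tsupport ψ ⊆ Y := (image_mono hψ.tsupport_subset).trans hA.image_eq.subset
  have hs : Function.support (transport A X Y ψ) ⊆ A '' tsupport ψ := by
    intro y hy
    have hyY : y ∈ Y := by
      by_contra h
      exact hy (indicator_of_notMem h _)
    have h1 : transport A X Y ψ y = _ := indicator_of_mem hyY _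
    refine ⟨Function.invFunOn A X y, subset_tsupport _ fun h0 => hy ?_, ?_⟩
    · rw [h1, h0, zero_div]
    · rw [← hA.image_eq] at hyY
      exact Function.invFunOn_eq hyY
  have hts : tsupport (transport A X Y ψ) ⊆ A '' tsupport ψ :=
    closure_minimal hs hK.isClosed
  refine ⟨?_, HasCompactSupport.of_support_subset_isCompact hK hs, hts.trans hKY⟩
  refine continuous_of_tsupport fun y hy => ?_
  have hyY := hKY (hts hy)
  have hc1 : ContinuousOn (transport A X Y ψ) Y := by
    refine ContinuousOn.congr (ContinuousOn.div
      (hψ.continuous.comp_continuousOn hA.continuousOn_invFunOn)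
      ((hA.continuousOn_absDet hX).comp hA.continuousOn_invFunOn hA.invFunOn_mem) ?_)
      fun y hy => indicator_of_mem hy _
    exact fun y hy => (hc.trans_le (hcd _ (hA.invFunOn_mem hy))).ne'
  exact hc1.continuousAt (hY.mem_nhds hyY)

end ChangeOfVariables

/-! ### The chain rule for weak derivatives and the Koopman operator -/

section Koopman

variable {d σ : ℕ} {X Y : Set (Euc d)} {A : Euc d → Euc d}

theorem IsTestFun.isContTestFun_multiDeriv {φ : Euc d → ℝ} (hφ : IsTestFun X φ) (α : Fin d → ℕ) :
    IsContTestFun X (multiDeriv α φ) := by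
  have h1 : Continuous (iteratedFDeriv ℝ (∑ i, α i) φ) :=
    hφ.contDiff.continuous_iteratedFDeriv (by exact_mod_cast le_top)
  have hc : Continuous (multiDeriv α φ) := (ContinuousMultilinearMap.apply ℝ _ ℝ
    (fun r => stdVec (stdArr α r))).continuous.comp h1
  have hs : tsupport (multiDeriv α φ) ⊆ tsupport φ := by
    refine (closure_mono ?_).trans (tsupport_iteratedFDeriv_subset (𝕜 := ℝ) (f := φ) (∑ i, α i))
    intro x hx h0
    refine hx ?_
    simp only [multiDeriv, partialDeriv, h0]
    rfl
  exact ⟨hc, hφ.hasCompactSupport.of_isClosed_subset isClosed_closure hs,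
    hs.trans hφ.tsupport_subset⟩

theorem IsTestFun.isContTestFun_mul {φ : Euc d → ℝ} (hφ : IsTestFun X φ) (hX : IsOpen X)
    {c : Euc d → ℝ} (hc : ContinuousOn c X) : IsContTestFun X fun x => c x * φ x :=
  ⟨continuous_mul_of_tsupport_subset hX hc hφ.contDiff.continuous hφ.tsupport_subset,
    hφ.hasCompactSupport.mul_left, tsupport_mul_subset_right.trans hφ.tsupport_subset⟩

/-- The expression that the Faà di Bruno formula gives for `D^α (u ∘ A)` in terms of the weak
derivatives `v α' = D^α' u`. -/
noncomputable def chainDeriv (A : Euc d → Euc d) (v : multiIdx d σ → L2 Y) (α : Fin d → ℕ)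
    (x : Euc d) : ℝ :=
  ∑ α' : multiIdx d σ, faaCoeff A (stdArr α) α' x * v α' (A x)

theorem chainDeriv_zeroIdx (v : multiIdx d σ → L2 Y) (x : Euc d) :
    chainDeriv A v (zeroIdx d σ) x = v (zeroIdx d σ) (A x) := by
  have h0 : ∑ i, (zeroIdx d σ : Fin d → ℕ) i = 0 := by simp [zeroIdx]
  unfold chainDeriv
  rw [Fintype.sum_eq_single (zeroIdx d σ)]
  · change faaCoeff A _ 0 x * _ = _
    rw [faaCoeff_zero_zero h0, one_mul]
  · intro α' hα'
    rw [faaCoeff_eq_zero_of_lt, zero_mul]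
    rw [h0, pos_iff_ne_zero]
    intro h
    refine hα' (Subtype.ext (funext fun i => ?_))
    exact Finset.sum_eq_zero_iff.1 h i (Finset.mem_univ i)

theorem memLp_faaCoeff_mul_comp (hX : IsOpen X) (hY : IsOpen Y) (hA : IsC1Diffeo A X Y)
    (hdet : ∃ c : ℝ, 0 < c ∧ ∀ x ∈ X, c ≤ absDet A x) (hcb : IsCb σ A X)
    (α α' : multiIdx d σ) (g : L2 Y) :
    MemLp (fun x => faaCoeff A (stdArr α) α' x * g (A x)) 2 (volume.restrict X) := by
  have hα := mem_multiIdx.1 α.2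
  obtain ⟨M, hM⟩ := exists_bound_faaCoeff hX hcb hα (stdArr (α : Fin d → ℕ)) α'
  have hg := hA.memLp_comp hX hY hdet (Lp.memLp g)
  have hc : ContinuousOn (faaCoeff A (stdArr α) α') X :=
    continuousOn_faaCoeff hX (hcb.1.of_le (by exact_mod_cast hα)) _ _
  refine hg.of_le_mul (c := M)
    ((hc.aestronglyMeasurable hX.measurableSet).mul hg.aestronglyMeasurable) ?_
  filter_upwards [ae_restrict_mem hX.measurableSet] with x hx
  rw [norm_mul]
  exact mul_le_mul_of_nonneg_right (hM x hx) (norm_nonneg _)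

theorem memLp_chainDeriv (hX : IsOpen X) (hY : IsOpen Y) (hA : IsC1Diffeo A X Y)
    (hdet : ∃ c : ℝ, 0 < c ∧ ∀ x ∈ X, c ≤ absDet A x) (hcb : IsCb σ A X)
    (v : multiIdx d σ → L2 Y) (α : multiIdx d σ) :
    MemLp (chainDeriv A v α) 2 (volume.restrict X) :=
  memLp_finsetSum _ fun α' _ => memLp_faaCoeff_mul_comp hX hY hA hdet hcb α α' (v α')

/-- The chain rule for weak derivatives, tested with `φ`. -/
theorem integral_comp_mul_multiDeriv (hX : IsOpen X) (hY : IsOpen Y)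
    (hYb : Bornology.IsBounded Y) (hA : IsC1Diffeo A X Y)
    (hdet : ∃ c : ℝ, 0 < c ∧ ∀ x ∈ X, c ≤ absDet A x) (hcb : IsCb σ A X)
    (u : SobolevH σ Y) (α : multiIdx d σ) {φ : Euc d → ℝ} (hφ : IsTestFun X φ) :
    ∫ x in X, sobFn u (A x) * multiDeriv α φ x =
      (-1) ^ (∑ i, (α : Fin d → ℕ) i) * ∫ x in X,
        chainDeriv A (fun α' => (u : PiLp 2 fun _ : multiIdx d σ => L2 Y) α') α x * φ x := by
  have hα := mem_multiIdx.1 α.2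
  have hAα : ContDiffOn ℝ (∑ i, (α : Fin d → ℕ) i : ℕ) A X :=
    hcb.1.of_le (by exact_mod_cast hα)
  have hc : ∀ α' : multiIdx d σ, ContinuousOn (faaCoeff A (stdArr α) α') X := fun α' =>
    continuousOn_faaCoeff hX hAα _ _
  have hw : ∀ α' : multiIdx d σ, IsContTestFun X fun x => faaCoeff A (stdArr α) α' x * φ x :=
    fun α' => hφ.isContTestFun_mul hX (hc α')
  -- the chain rule for smooth `h`, transported from `X` to `Y`
  have H : ∀ h : Euc d → ℝ, ContDiff ℝ ∞ h →
      ∫ y in Y, h y * transport A X Y (multiDeriv α φ) y =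
      (-1) ^ (∑ i, (α : Fin d → ℕ) i) * ∑ α' : multiIdx d σ, ∫ y in Y, multiDeriv α' h y *
        transport A X Y (fun x => faaCoeff A (stdArr α) α' x * φ x) y := by
    intro h hh
    simp only [hA.integral_mul_transport hX hdet]
    have hF : ContDiffOn ℝ (∑ i, (α : Fin d → ℕ) i : ℕ) (fun x => h (A x)) X :=
      (hh.of_le (by exact_mod_cast le_top)).comp_contDiffOn hAα
    rw [show multiDeriv α φ = partialDeriv (stdArr α) φ from rfl,
      integral_mul_partialDeriv hX hF _ hφ]
    congr 1
    rw [← integral_finsetSum]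
    · refine setIntegral_congr_fun hX.measurableSet fun x hx => ?_
      rw [partialDeriv_comp_eq_sum hα (hAα.contDiffAt (hX.mem_nhds hx))
        (hh.of_le (by exact_mod_cast le_top)).contDiffAt, ← Finset.sum_coe_sort, Finset.sum_mul]
      exact Finset.sum_congr rfl fun α' _ => by ring
    · intro α' _
      have hm : ContinuousOn (fun x => multiDeriv α' h (A x)) X := by
        have h1 : Continuous (multiDeriv α' h) :=
          (ContinuousMultilinearMap.apply ℝ _ ℝ
            (fun r => stdVec (stdArr (α' : Fin d → ℕ) r))).continuous.comp
            (hh.continuous_iteratedFDeriv (by exact_mod_cast le_top))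
        exact h1.comp_continuousOn hA.contDiffOn.continuousOn
      exact ((continuous_mul_of_tsupport_subset hX hm (hw α').continuous
        (hw α').tsupport_subset).integrable_of_hasCompactSupport
          (hw α').hasCompactSupport.mul_left).integrableOn
  have key := integral_sobolev_mul_eq hY hYb
    (hA.isContTestFun_transport hX hY hdet (hφ.isContTestFun_multiDeriv α))
    (fun α' => hA.isContTestFun_transport hX hY hdet (hw α')) H u
  simp only [hA.integral_mul_transport hX hdet] at key
  rw [key, ← integral_finsetSum]
  · congr 1
    refine integral_congr_ae (Filter.Eventually.of_forall fun x => ?_)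
    simp only [chainDeriv]
    rw [Finset.sum_mul]
    exact Finset.sum_congr rfl fun α' _ => by ring
  · intro α' _
    have h1 := (memLp_faaCoeff_mul_comp hX hY hA hdet hcb α α'
      ((u : PiLp 2 fun _ : multiIdx d σ => L2 Y) α')).integrable_mul hφ.memLp
    refine h1.congr (Filter.Eventually.of_forall fun x => ?_)
    simp only [Pi.mul_apply]
    ring

/-- The Koopman operator as a linear map between Sobolev spaces. The weak derivatives of `u ∘ A` are
those given by the Faà di Bruno formula. -/
noncomputable def koopmanLin (hX : IsOpen X) (hY : IsOpen Y) (hYb : Bornology.IsBounded Y)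
    (hA : IsC1Diffeo A X Y) (hdet : ∃ c : ℝ, 0 < c ∧ ∀ x ∈ X, c ≤ absDet A x)
    (hcb : IsCb σ A X) : SobolevH σ Y →ₗ[ℝ] SobolevH σ X where
  toFun u := ⟨WithLp.toLp 2 fun α => (memLp_chainDeriv hX hY hA hdet hcb
      (fun α' => (u : PiLp 2 fun _ : multiIdx d σ => L2 Y) α') α).toLp _, by
    intro α φ hφ
    have h0 := (memLp_chainDeriv hX hY hA hdet hcb
      (fun α' => (u : PiLp 2 fun _ : multiIdx d σ => L2 Y) α') (zeroIdx d σ)).coeFn_toLp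
    have hα := (memLp_chainDeriv hX hY hA hdet hcb
      (fun α' => (u : PiLp 2 fun _ : multiIdx d σ => L2 Y) α') α).coeFn_toLp
    refine Eq.trans ?_ ((integral_comp_mul_multiDeriv hX hY hYb hA hdet hcb u α hφ).trans ?_)
    · refine integral_congr_ae ?_
      filter_upwards [h0] with x hx
      rw [hx, chainDeriv_zeroIdx]
      rfl
    · congr 1
      refine integral_congr_ae ?_
      filter_upwards [hα] with x hx
      rw [hx]⟩
  map_add' u v := by
    refine Subtype.ext (PiLp.ext fun α => ?_)
    change (memLp_chainDeriv hX hY hA hdet hcb _ α).toLp _ =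
      (memLp_chainDeriv hX hY hA hdet hcb _ α).toLp _ +
      (memLp_chainDeriv hX hY hA hdet hcb _ α).toLp _
    rw [← MemLp.toLp_add, MemLp.toLp_eq_toLp_iff]
    have h : ∀ α' : multiIdx d σ, ∀ᵐ x ∂volume.restrict X, _ := fun α' =>
      hA.ae_comp hX hY (Lp.coeFn_add ((u : PiLp 2 fun _ : multiIdx d σ => L2 Y) α')
        ((v : PiLp 2 fun _ : multiIdx d σ => L2 Y) α'))
    filter_upwards [ae_all_iff.2 h] with x hx
    simp only [chainDeriv, Pi.add_apply]
    rw [← Finset.sum_add_distrib]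
    refine Finset.sum_congr rfl fun α' _ => ?_
    rw [← mul_add]
    exact congrArg _ (hx α')
  map_smul' c u := by
    refine Subtype.ext (PiLp.ext fun α => ?_)
    change (memLp_chainDeriv hX hY hA hdet hcb _ α).toLp _ =
      c • (memLp_chainDeriv hX hY hA hdet hcb _ α).toLp _
    rw [← MemLp.toLp_const_smul, MemLp.toLp_eq_toLp_iff]
    have h : ∀ α' : multiIdx d σ, ∀ᵐ x ∂volume.restrict X, _ := fun α' =>
      hA.ae_comp hX hY (Lp.coeFn_smul c ((u : PiLp 2 fun _ : multiIdx d σ => L2 Y) α'))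
    filter_upwards [ae_all_iff.2 h] with x hx
    simp only [chainDeriv, Pi.smul_apply, Finset.smul_sum]
    refine Finset.sum_congr rfl fun α' _ => ?_
    exact (congrArg _ (hx α')).trans (mul_smul_comm c _ _)

end Koopman

/-! ### The operator norm -/

section Norm

variable {d σ : ℕ} {X Y : Set (Euc d)} {A : Euc d → Euc d}

theorem coeFn_koopmanLin (hX : IsOpen X) (hY : IsOpen Y) (hYb : Bornology.IsBounded Y)
    (hA : IsC1Diffeo A X Y) (hdet : ∃ c : ℝ, 0 < c ∧ ∀ x ∈ X, c ≤ absDet A x)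
    (hcb : IsCb σ A X) (u : SobolevH σ Y) (α : multiIdx d σ) :
    (koopmanLin hX hY hYb hA hdet hcb u : PiLp 2 fun _ : multiIdx d σ => L2 X) α
      =ᵐ[volume.restrict X]
      chainDeriv A (fun α' => (u : PiLp 2 fun _ : multiIdx d σ => L2 Y) α') α :=
  (memLp_chainDeriv hX hY hA hdet hcb _ α).coeFn_toLp

theorem norm_sq_L2 {Ω : Set (Euc d)} (f : L2 Ω) : ‖f‖ ^ 2 = ∫ x in Ω, f x ^ 2 := by
  rw [← real_inner_self_eq_norm_sq, L2.inner_def]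
  refine integral_congr_ae (Filter.Eventually.of_forall fun x => ?_)
  simp [sq]

/-- The pointwise form of the norm estimate. The term of order zero is controlled by `|det DA|⁻¹`,
the remaining terms by the Cauchy-Schwarz inequality. -/
theorem sum_chainDeriv_sq_le {C : ℝ} {x : Euc d} (hdet : 0 < absDet A x)
    (hC : (absDet A x)⁻¹ ≤ C)
    (hQ : ∑ α ∈ Finset.univ.erase (zeroIdx d σ), ∑ α' ∈ Finset.univ.erase (zeroIdx d σ),
      |faaCoeff A (stdArr (α : Fin d → ℕ)) α' x| ^ 2 ≤ C * absDet A x)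
    (v : multiIdx d σ → L2 Y) :
    ∑ α : multiIdx d σ, chainDeriv A v α x ^ 2 ≤
      C * ∑ α : multiIdx d σ, absDet A x * v α (A x) ^ 2 := by
  rw [← Finset.mul_sum, ← mul_assoc, ← Finset.add_sum_erase _ _ (Finset.mem_univ (zeroIdx d σ)),
    ← Finset.add_sum_erase _ (fun α => v α (A x) ^ 2) (Finset.mem_univ (zeroIdx d σ)), mul_add]
  refine add_le_add ?_ ?_
  · rw [chainDeriv_zeroIdx]
    refine le_mul_of_one_le_left (sq_nonneg _) ?_
    rwa [inv_le_iff_one_le_mul₀ hdet] at hC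
  · refine le_trans ?_ (mul_le_mul_of_nonneg_right hQ (Finset.sum_nonneg fun _ _ => sq_nonneg _))
    rw [Finset.sum_mul]
    refine Finset.sum_le_sum fun α hα => ?_
    have hpos : 0 < ∑ i, (α : Fin d → ℕ) i := by
      rw [pos_iff_ne_zero]
      intro h
      refine Finset.ne_of_mem_erase hα (Subtype.ext (funext fun i => ?_))
      exact Finset.sum_eq_zero_iff.1 h i (Finset.mem_univ i)
    have h0 : chainDeriv A v α x = ∑ α' ∈ Finset.univ.erase (zeroIdx d σ),
        faaCoeff A (stdArr (α : Fin d → ℕ)) α' x * v α' (A x) := by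
      unfold chainDeriv
      rw [← Finset.add_sum_erase _ _ (Finset.mem_univ (zeroIdx d σ))]
      change faaCoeff A _ 0 x * _ + _ = _
      rw [faaCoeff_zero_right hpos, zero_mul, zero_add]
    rw [h0]
    simp only [sq_abs]
    exact Finset.sum_mul_sq_le_sq_mul_sq _ _ _

theorem norm_koopmanLin_le (hX : IsOpen X) (hY : IsOpen Y) (hYb : Bornology.IsBounded Y)
    (hA : IsC1Diffeo A X Y) (hdet : ∃ c : ℝ, 0 < c ∧ ∀ x ∈ X, c ≤ absDet A x)
    (hcb : IsCb σ A X) {C : ℝ} (hC0 : 0 ≤ C) (hC : ∀ x ∈ X, (absDet A x)⁻¹ ≤ C)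
    (hQ : ∀ x ∈ X, ∑ α ∈ Finset.univ.erase (zeroIdx d σ), ∑ α' ∈ Finset.univ.erase (zeroIdx d σ),
      |faaCoeff A (stdArr (α : Fin d → ℕ)) α' x| ^ 2 ≤ C * absDet A x) (u : SobolevH σ Y) :
    ‖koopmanLin hX hY hYb hA hdet hcb u‖ ≤ Real.sqrt C * ‖u‖ := by
  set v : multiIdx d σ → L2 Y := fun α' => (u : PiLp 2 fun _ : multiIdx d σ => L2 Y) α'
  have hv2 : ∀ α, IntegrableOn (fun x => absDet A x * v α (A x) ^ 2) X := fun α =>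
    (hA.integrableOn_iff hX _).1 (Lp.memLp (v α)).integrable_sq
  have hsq : ‖koopmanLin hX hY hYb hA hdet hcb u‖ ^ 2 ≤ C * ‖u‖ ^ 2 := by
    have h1 : ‖koopmanLin hX hY hYb hA hdet hcb u‖ ^ 2 =
        ∫ x in X, ∑ α : multiIdx d σ, chainDeriv A v α x ^ 2 := by
      rw [Submodule.coe_norm, PiLp.norm_sq_eq_of_L2, integral_finsetSum]
      · refine Finset.sum_congr rfl fun α _ => ?_
        rw [norm_sq_L2]
        refine integral_congr_ae ?_
        filter_upwards [coeFn_koopmanLin hX hY hYb hA hdet hcb u α] with x hx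
        rw [hx]
      · exact fun α _ => (memLp_chainDeriv hX hY hA hdet hcb v α).integrable_sq
    have h2 : ‖u‖ ^ 2 = ∫ x in X, ∑ α : multiIdx d σ, absDet A x * v α (A x) ^ 2 := by
      rw [Submodule.coe_norm, PiLp.norm_sq_eq_of_L2, integral_finsetSum _ fun α _ => hv2 α]
      refine Finset.sum_congr rfl fun α _ => ?_
      rw [norm_sq_L2, hA.setIntegral_eq hX]
    rw [h1, h2, ← integral_const_mul]
    refine setIntegral_mono_on ?_ ?_ hX.measurableSet fun x hx => ?_
    · exact integrable_finsetSum _ fun α _ =>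
        (memLp_chainDeriv hX hY hA hdet hcb v α).integrable_sq
    · exact (integrable_finsetSum _ fun α _ => hv2 α).const_mul _
    · obtain ⟨c, hc, hcd⟩ := hdet
      exact sum_chainDeriv_sq_le (hc.trans_le (hcd x hx)) (hC x hx) (hQ x hx) v
  refine le_of_sq_le_sq ?_ (by positivity)
  rwa [mul_pow, Real.sq_sqrt hC0]

/-- The Koopman operator is bounded by `√C` as soon as `C` dominates `|det DA|⁻¹` and the squared
Faà di Bruno coefficients of positive order, divided by `|det DA|`. -/
theorem exists_isKoopman_norm_le (hX : IsOpen X) (hY : IsOpen Y) (hYb : Bornology.IsBounded Y)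
    (hA : IsC1Diffeo A X Y) (hdet : ∃ c : ℝ, 0 < c ∧ ∀ x ∈ X, c ≤ absDet A x)
    (hcb : IsCb σ A X) {C : ℝ} (hC0 : 0 ≤ C) (hC : ∀ x ∈ X, (absDet A x)⁻¹ ≤ C)
    (hQ : ∀ x ∈ X, ∑ α ∈ Finset.univ.erase (zeroIdx d σ), ∑ α' ∈ Finset.univ.erase (zeroIdx d σ),
      |faaCoeff A (stdArr (α : Fin d → ℕ)) α' x| ^ 2 ≤ C * absDet A x) :
    ∃ K : SobolevH σ Y →L[ℝ] SobolevH σ X, IsKoopman A K ∧ ‖K‖ ≤ Real.sqrt C := by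
  refine ⟨(koopmanLin hX hY hYb hA hdet hcb).mkContinuous (Real.sqrt C)
    (norm_koopmanLin_le hX hY hYb hA hdet hcb hC0 hC hQ), ?_,
    LinearMap.mkContinuous_norm_le _ (Real.sqrt_nonneg _) _⟩
  intro u f hf
  filter_upwards [hA.ae_comp hX hY hf,
    coeFn_koopmanLin hX hY hYb hA hdet hcb u (zeroIdx d σ)] with x hx h2
  rw [hx]
  refine Eq.trans ?_ h2.symm
  rw [chainDeriv_zeroIdx]
  rfl

end Norm

/-! ### The constants in the estimates -/

section Constants

variable {d σ : ℕ} {X Y : Set (Euc d)} {A : Euc d → Euc d}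

theorem sum_erase_zeroIdx (f : (Fin d → ℕ) → ℝ) :
    ∑ α ∈ Finset.univ.erase (zeroIdx d σ), f α = ∑ α ∈ multiIdx d σ with 1 ≤ ∑ i, α i, f α := by
  classical
  refine Finset.sum_bij (fun α _ => (α : Fin d → ℕ)) ?_ ?_ ?_ ?_
  · intro α hα
    refine Finset.mem_filter.2 ⟨α.2, Nat.one_le_iff_ne_zero.2 fun h => ?_⟩
    refine Finset.ne_of_mem_erase hα (Subtype.ext (funext fun i => ?_))
    exact Finset.sum_eq_zero_iff.1 h i (Finset.mem_univ i)
  · intro a _ b _ h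
    exact Subtype.ext h
  · intro α hα
    obtain ⟨h1, h2⟩ := Finset.mem_filter.1 hα
    refine ⟨⟨α, h1⟩, Finset.mem_erase.2 ⟨?_, Finset.mem_univ _⟩, rfl⟩
    intro h
    have : α = 0 := congrArg Subtype.val h
    subst this
    simp at h2
  · intro _ _
    rfl

/-- A sum over the non-zero multi-indices, arranged by their order. -/
theorem sum_erase_zeroIdx_eq_sum_Icc {m : ℕ} (hm : m ≤ σ) (f : (Fin d → ℕ) → ℝ)
    (hf : ∀ α, m < ∑ i, α i → f α = 0) :
    ∑ α ∈ Finset.univ.erase (zeroIdx d σ), f α =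
      ∑ k ∈ Finset.Icc 1 m, ∑ α ∈ Finset.piAntidiag (Finset.univ : Finset (Fin d)) k, f α := by
  classical
  rw [sum_erase_zeroIdx]
  have h1 : ∑ α ∈ multiIdx d σ with 1 ≤ ∑ i, α i, f α =
      ∑ α ∈ multiIdx d σ with (∑ i, α i) ∈ Finset.Icc 1 m, f α := by
    symm
    refine Finset.sum_subset ?_ ?_
    · intro α hα
      simp only [Finset.mem_filter, Finset.mem_Icc] at hα ⊢
      exact ⟨hα.1, hα.2.1⟩
    · intro α hα hα'
      simp only [Finset.mem_filter, Finset.mem_Icc] at hα hα'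
      refine hf α (not_le.1 fun h => hα' ⟨hα.1, hα.2, h⟩)
  rw [h1, ← Finset.sum_fiberwise_of_maps_to (t := Finset.Icc 1 m) (g := fun α => ∑ i, α i)]
  · refine Finset.sum_congr rfl fun k hk => Finset.sum_congr ?_ fun _ _ => rfl
    ext α
    simp only [Finset.mem_filter, mem_multiIdx, Finset.mem_piAntidiag, Finset.mem_Icc] at hk ⊢
    constructor
    · rintro ⟨_, h⟩
      exact ⟨h, fun _ _ => Finset.mem_univ _⟩
    · rintro ⟨h, _⟩
      change ∑ i, α i = k at h
      exact ⟨⟨by omega, by omega⟩, h⟩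
  · intro α hα
    exact (Finset.mem_filter.1 hα).2

theorem inv_absDet_le_c0 (hdet : ∃ c : ℝ, 0 < c ∧ ∀ x ∈ X, c ≤ absDet A x) {x : Euc d}
    (hx : x ∈ X) : (absDet A x)⁻¹ ≤ c0 A X := by
  obtain ⟨c, hc, hcd⟩ := hdet
  refine le_ciSup (f := fun x : X => (absDet A x)⁻¹) ⟨c⁻¹, ?_⟩ ⟨x, hx⟩
  rintro _ ⟨y, rfl⟩
  exact inv_anti₀ hc (hcd y y.2)

theorem c0_nonneg (A : Euc d → Euc d) (X : Set (Euc d)) : 0 ≤ c0 A X :=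
  Real.iSup_nonneg fun _ => inv_nonneg.2 (abs_nonneg _)

/-- The supremum defining `S_α(A)` is finite, so that it bounds its terms. -/
theorem sum_faaCoeff_sq_le_S (hX : IsOpen X) (hcb : IsCb σ A X)
    (hdet : ∃ c : ℝ, 0 < c ∧ ∀ x ∈ X, c ≤ absDet A x) {α : Fin d → ℕ} (hα : ∑ i, α i ≤ σ)
    {x : Euc d} (hx : x ∈ X) :
    ∑ k ∈ Finset.Icc 1 (∑ i, α i), ∑ α' ∈ Finset.piAntidiag (Finset.univ : Finset (Fin d)) k,
      |faaCoeff A (stdArr α) α' x| ^ 2 ≤ S A X α * absDet A x := by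
  obtain ⟨c, hc, hcd⟩ := hdet
  have hpos : 0 < absDet A x := hc.trans_le (hcd x hx)
  rw [← div_le_iff₀ hpos, div_eq_inv_mul]
  choose M hM using fun α' => exists_bound_faaCoeff hX hcb hα (stdArr α) α'
  refine le_ciSup (f := fun x : X => (absDet A x)⁻¹ * ∑ k ∈ Finset.Icc 1 (∑ i, α i),
    ∑ α' ∈ Finset.piAntidiag (Finset.univ : Finset (Fin d)) k,
      |faaCoeff A (stdArr α) α' x| ^ 2) ⟨c⁻¹ * ∑ k ∈ Finset.Icc 1 (∑ i, α i),
    ∑ α' ∈ Finset.piAntidiag (Finset.univ : Finset (Fin d)) k, M α' ^ 2, ?_⟩ ⟨x, hx⟩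
  rintro _ ⟨y, rfl⟩
  refine mul_le_mul (inv_anti₀ hc (hcd y y.2)) ?_ (by positivity) (by positivity)
  exact Finset.sum_le_sum fun k _ => Finset.sum_le_sum fun α' _ =>
    pow_le_pow_left₀ (abs_nonneg _) (hM α' y y.2) 2

theorem sum_faaCoeff_sq_le_sum_S (hX : IsOpen X) (hcb : IsCb σ A X)
    (hdet : ∃ c : ℝ, 0 < c ∧ ∀ x ∈ X, c ≤ absDet A x) {x : Euc d} (hx : x ∈ X) :
    ∑ α ∈ Finset.univ.erase (zeroIdx d σ), ∑ α' ∈ Finset.univ.erase (zeroIdx d σ),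
      |faaCoeff A (stdArr (α : Fin d → ℕ)) α' x| ^ 2 ≤
    (∑ α ∈ multiIdx d σ with 1 ≤ ∑ i, α i, S A X α) * absDet A x := by
  rw [Finset.sum_mul, ← sum_erase_zeroIdx (fun α => S A X α * absDet A x)]
  refine Finset.sum_le_sum fun α _ => ?_
  have hα := mem_multiIdx.1 α.2
  rw [sum_erase_zeroIdx_eq_sum_Icc hα
    (fun α' => |faaCoeff A (stdArr (α : Fin d → ℕ)) α' x| ^ 2)]
  · exact sum_faaCoeff_sq_le_S hX hcb hdet hα hx
  · intro α' h
    simp [faaCoeff_eq_zero_of_lt h]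

/-- The multi-indices of order one are the standard basis vectors. -/
theorem sum_erase_zeroIdx_one (f : (Fin d → ℕ) → ℝ) :
    ∑ α ∈ Finset.univ.erase (zeroIdx d 1), f α = ∑ i, f (Pi.single i 1) := by
  classical
  rw [sum_erase_zeroIdx]
  symm
  refine Finset.sum_bij (fun i _ => Pi.single i 1) ?_ ?_ ?_ ?_
  · intro i _
    simp [mem_multiIdx]
  · intro i _ j _ h
    by_contra hne
    have := congrFun h i
    simp [hne] at this
  · intro α hα
    obtain ⟨h1, h2⟩ := Finset.mem_filter.1 hα
    have h3 : ∑ i, α i = 1 := le_antisymm (mem_multiIdx.1 h1) h2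
    obtain ⟨i, _, hi⟩ := Finset.exists_ne_zero_of_sum_ne_zero (h3.trans_ne one_ne_zero)
    refine ⟨i, Finset.mem_univ _, funext fun j => ?_⟩
    have h4 := Finset.add_sum_erase Finset.univ α (Finset.mem_univ i)
    by_cases hj : j = i
    · subst hj
      simp
      omega
    · have h5 := Finset.single_le_sum (f := α) (fun _ _ => Nat.zero_le _)
        (Finset.mem_erase.2 ⟨hj, Finset.mem_univ j⟩)
      simp [hj]
      omega
  · intro _ _
    rfl

/-- For `σ = 1` the sum of the squared Faà di Bruno coefficients is the squared Frobenius norm. -/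
theorem sum_faaCoeff_sq_eq_frobSq {x : Euc d} (hA : ContDiffAt ℝ 1 A x) :
    ∑ α ∈ Finset.univ.erase (zeroIdx d 1), ∑ α' ∈ Finset.univ.erase (zeroIdx d 1),
      |faaCoeff A (stdArr (α : Fin d → ℕ)) α' x| ^ 2 = frobSq A x := by
  rw [sum_erase_zeroIdx_one (fun α => ∑ α' ∈ Finset.univ.erase (zeroIdx d 1),
      |faaCoeff A (stdArr α) α' x| ^ 2)]
  unfold frobSq
  refine Eq.trans (Finset.sum_congr rfl fun i _ => ?_) Finset.sum_comm
  rw [sum_erase_zeroIdx_one (fun α' => |faaCoeff A (stdArr (Pi.single i 1)) α' x| ^ 2)]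
  refine Finset.sum_congr rfl fun j _ => ?_
  rw [faaCoeff_single (by simp) _ hA (isArrangement_stdArr _), sq_abs]

/-- The supremum of `‖DA‖_F² / |det DA|` is finite, so that it bounds its terms. -/
theorem frobSq_le (hcb : IsCb 1 A X) (hdet : ∃ c : ℝ, 0 < c ∧ ∀ x ∈ X, c ≤ absDet A x)
    {x : Euc d} (hx : x ∈ X) : frobSq A x ≤ (⨆ x : X, frobSq A x / absDet A x) * absDet A x := by
  obtain ⟨c, hc, hcd⟩ := hdet
  have hpos : 0 < absDet A x := hc.trans_le (hcd x hx)
  rw [← div_le_iff₀ hpos]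
  obtain ⟨M, hM⟩ := hcb.2 1 le_rfl
  refine le_ciSup (f := fun x : X => frobSq A x / absDet A x)
    ⟨(∑ _i : Fin d, ∑ _j : Fin d, M ^ 2) / c, ?_⟩ ⟨x, hx⟩
  rintro _ ⟨y, rfl⟩
  refine div_le_div₀ (by positivity) ?_ hc (hcd y y.2)
  refine Finset.sum_le_sum fun i _ => Finset.sum_le_sum fun j _ => ?_
  rw [← sq_abs]
  refine pow_le_pow_left₀ (abs_nonneg _) ?_ 2
  refine (PiLp.norm_apply_le (fderiv ℝ A y (stdVec j)) i).trans ?_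
  refine ((fderiv ℝ A y).le_opNorm _).trans ?_
  rw [← norm_iteratedFDeriv_one (𝕜 := ℝ)]
  simpa using hM y y.2

end Constants

end KoopmanSobolev

theorem mainTheorem9 {d : ℕ} (X Y : Set (Euc d))
    (hX : IsBoundedLipschitzDomain X) (hY : IsBoundedLipschitzDomain Y)
    (A : Euc d → Euc d) (hA : IsC1Diffeo A X Y)
    (hdet : ∃ c : ℝ, 0 < c ∧ ∀ x ∈ X, c ≤ absDet A x) :
    (∀ σ : ℕ, 1 ≤ σ → IsCb σ A X →
      (∀ α ∈ multiIdx d σ, ∀ β : Fin (∑ i, α i) → Fin d, IsArrangement α β →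
        SArr A X β = S A X α) ∧
      ∃ K : SobolevH σ Y →L[ℝ] SobolevH σ X, IsKoopman A K ∧
        ‖K‖ ≤ Real.sqrt (max (c0 A X) (∑ α ∈ multiIdx d σ with 1 ≤ ∑ i, α i, S A X α))) ∧
    (IsCb 1 A X →
      ∃ K : SobolevH 1 Y →L[ℝ] SobolevH 1 X, IsKoopman A K ∧
        ‖K‖ ≤ Real.sqrt (max (c0 A X) (⨆ x : X, frobSq A x / absDet A x))) := by
  have h0 : ∀ b : ℝ, 0 ≤ max (c0 A X) b := fun b => (c0_nonneg A X).trans (le_max_left _ _)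
  have hinv : ∀ b : ℝ, ∀ x ∈ X, (absDet A x)⁻¹ ≤ max (c0 A X) b := fun b x hx =>
    (inv_absDet_le_c0 hdet hx).trans (le_max_left _ _)
  refine ⟨fun σ _ hcb => ⟨fun α hα β hβ => ?_, ?_⟩, fun hcb => ?_⟩
  · exact SArr_eq_S hX.isOpen (hcb.1.of_le (by exact_mod_cast mem_multiIdx.1 hα)) hβ
  · refine exists_isKoopman_norm_le hX.isOpen hY.isOpen hY.isBounded hA hdet hcb (h0 _) (hinv _)
      fun x hx => (sum_faaCoeff_sq_le_sum_S hX.isOpen hcb hdet hx).trans ?_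
    exact mul_le_mul_of_nonneg_right (le_max_right _ _) (abs_nonneg _)
  · refine exists_isKoopman_norm_le hX.isOpen hY.isOpen hY.isBounded hA hdet hcb (h0 _) (hinv _)
      fun x hx => ?_
    rw [sum_faaCoeff_sq_eq_frobSq (hA.contDiffOn.contDiffAt (hX.isOpen.mem_nhds hx))]
    exact (frobSq_le hcb hdet hx).trans
      (mul_le_mul_of_nonneg_right (le_max_right _ _) (abs_nonneg _))
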